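/- **Setting.** Let $\Omega\subset\mathbb R^3$ be a bounded Lipschitz domain (open, connected, nonempty, Lipschitz boundary) and $B\subset\Omega$ a Lipschitz domain. Let $\boldsymbol E_d\in C^1(B;\mathbb R^3)$ and $\kappa\in C^1(B)$ with $\kappa>0$, where $C^1(B)$ is the Banach space of continuously differentiable functions on $B$ that are bounded together with their first derivatives. Let $j_c>0$, let $\boldsymbol f\in L^2(\Omega;\mathbb R^3)\cap C^1(B;\mathbb R^3)$, and let $\epsilon,\nu\in L^\infty(\Omega;\mathbb R^{3\times3})\cap C^1(B;\mathbb R^{3\times 3})$ be symmetric and uniformly positive definite a.e. in $\Omega$. Let $\boldsymbol H_0(\mathbf{curl})$ be the closure of $C_0^\infty(\Omega;\mathbb R^3)$ in the norm $(\|\boldsymbol v\|_{L^2}^2+\|\mathbf{curl}\,\boldsymbol v\|_{L^2}^2)^{1/2}$, with dual $\boldsymbol H_0(\mathbf{curl})^*$, and $$a(\boldsymbol v,\boldsymbol w)=\int_\Omega \nu\,\mathbf{curl}\,\boldsymbol v\cdot\mathbf{curl}\,\boldsymbol w\,dx+\int_\Omega\epsilon\,\boldsymbol v\cdot\boldsymbol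 w\,dx .$$ *Admissible shapes.* Fix $L\ge 0$, $r>0$ and $h>0$. Let $\mathcal O$ be the set of all open $\omega\subset B$ that are uniformly Lipschitz with constant $L$: for every $x\in\partial\omega$ there are an orthonormal coordinate system $(y',y_3)\in\mathbb R^2\times\mathbb R$ centred at $x$ and an $L$-Lipschitz function $g:\mathbb R^2\to\mathbb R$ with $g(0)=0$ such that, in the cylinder $\{|y'|<r,\ |y_3|<h\}$, $\omega$ coincides with $\{y_3>g(y')\}$. *Original problem* $(P)$. For $\omega\in\mathcal O$ let $\boldsymbol E(\omega)\in \boldsymbol H_0(\mathbf{curl})$ be the solution of $$a(\boldsymbol E,\boldsymbol v-\boldsymbol E)+j_c\int_\omega|\boldsymbol v|\,dx-j_c\int_\omega|\boldsymbol E|\,dx\ \ge\ \int_\Omega\boldsymbol f\cdot(\boldsymbol v-\boldsymbol E)\,dx\qquad\forall\,\boldsymbol v\in\boldsymbol H_0(\mathbf{curl}).$$ Problem $(P)$ is to minimize $J(\omega)=\frac12\int_B\kappa|\boldsymbol E(\omega)-\boldsymbol E_d|^2dx+\int_\omega dx$ over $\omega\in\mathcal O$. With the multiplier $\boldsymbol\lambda(\omega)\in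 L^\infty(\omega;\mathbb R^3)$, the pair $(\boldsymbol E(\omega),\boldsymbol\lambda(\omega))$ is the solution of $$a(\boldsymbol E,\boldsymbol v)+\int_\omega\boldsymbol\lambda\cdot\boldsymbol v\,dx=\int_\Omega\boldsymbol f\cdot\boldsymbol v\,dx\quad\forall\,\boldsymbol v\in\boldsymbol H_0(\mathbf{curl}),\qquad |\boldsymbol\lambda|\le j_c,\quad \boldsymbol\lambda\cdot\boldsymbol E=j_c|\boldsymbol E|\ \text{ a.e. in }\omega. \tag{1}$$ *Penalized problem* $(P_\gamma)$, $\gamma>0$. Let $(\boldsymbol E^\gamma(\omega),\boldsymbol\lambda^\gamma(\omega))$ be the solution of $$a(\boldsymbol E^\gamma,\boldsymbol v)+\int_\omega\boldsymbol\lambda^\gamma\cdot\boldsymbol v\,dx=\int_\Omega\boldsymbol f\cdot\boldsymbol v\,dx\quad\forall\,\boldsymbol v\in\boldsymbol H_0(\mathbf{curl}),\qquad \boldsymbol\lambda^\gamma=\frac{j_c\gamma\boldsymbol E^\gamma}{\max_\gamma\{1,\gamma|\boldsymbol E^\gamma|\}}\ \text{ a.e. in }\omega,$$ where $\max_\gamma\{1,x\}$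 equals $x$ if $x-1\ge\frac1{2\gamma}$, $1+\frac\gamma2\bigl(x-1+\frac1{2\gamma}\bigr)^2$ if $|x-1|\le\frac1{2\gamma}$, and $1$ if $x-1\le-\frac1{2\gamma}$. Problem $(P_\gamma)$ is to minimize $J_\gamma(\omega)=\frac12\int_B\kappa|\boldsymbol E^\gamma(\omega)-\boldsymbol E_d|^2dx+\int_\omega dx$ over $\omega\in\mathcal O$. **Theorem.** Let $\gamma_n>0$ with $\gamma_n\to\infty$, and for every $n$ let $\omega^{\gamma_n}\in\mathcal O$ be an optimal shape of $(P_{\gamma_n})$. Then there is a subsequence, still denoted by $(\gamma_n)$, and an optimal shape $\omega_\star\in\mathcal O$ of $(P)$ such that $\omega^{\gamma_n}\to\omega_\star$ in the sense of Hausdorff (the complements converge in the Hausdorff distance) and in the sense of characteristic functions ($\chi_{\omega^{\gamma_n}}\to\chi_{\omega_\star}$ in $L^p(\mathbb R^3)$ for every $p\in[1,\infty)$). Moreover, $(1)$ for $\omega=\omega_\star$ has a unique solution $(\boldsymbol E(\omega_\star),\boldsymbol\lambda(\omega_\star))$, and $$\lim_{n\to\infty}\|\boldsymbol E^{\gamma_n}(\omega^{\gamma_n})-\boldsymbol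 E(\omega_\star)\|_{\boldsymbol H_0(\mathbf{curl})}=0,\qquad \lim_{n\to\infty}\|\boldsymbol\lambda^{\gamma_n}(\omega^{\gamma_n})-\boldsymbol\lambda(\omega_\star)\|_{\boldsymbol H_0(\mathbf{curl})^*}=0,$$ where the multipliers are extended by zero to $\Omega$ and act on $\boldsymbol H_0(\mathbf{curl})$ through the $L^2(\Omega;\mathbb R^3)$ inner product. -/

import Mathlib

open MeasureTheory Filter Topology
open scoped ENNReal NNReal

noncomputable section

namespace HTS

/-! ### Function spaces -/

/-- Euclidean space `ℝ³`. -/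
abbrev E3 : Type := EuclideanSpace ℝ (Fin 3)

/-- The space `L²(Ω; ℝ³)`. -/
abbrev L2 (Ω : Set E3) : Type := Lp E3 2 (volume.restrict Ω)

/-- Classical `i`-th partial derivative of the `j`-th component of a vector field. -/
def pd (φ : E3 → E3) (i j : Fin 3) (x : E3) : ℝ :=
  (fderiv ℝ φ x (EuclideanSpace.single i 1)) j

/-- Classical curl of a vector field on `ℝ³`. -/
def curl (φ : E3 → E3) (x : E3) : E3 :=
  !₂[pd φ 1 2 x - pd φ 2 1 x, pd φ 2 0 x - pd φ 0 2 x, pd φ 0 1 x - pd φ 1 0 x]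

/-- `φ ∈ C₀^∞(Ω; ℝ³)`: smooth, with compact support contained in `Ω`. -/
structure IsTest (Ω : Set E3) (φ : E3 → E3) : Prop where
  smooth : ContDiff ℝ (⊤ : ℕ∞) φ
  compact : HasCompactSupport φ
  supp : tsupport φ ⊆ Ω

/-- `w` is the distributional curl of `v` on `Ω`. -/
def HasWeakCurl (Ω : Set E3) (v w : E3 → E3) : Prop :=
  ∀ ψ : E3 → E3, IsTest Ω ψ →
    ∫ x in Ω, inner ℝ (w x) (ψ x) = ∫ x in Ω, inner ℝ (v x) (curl ψ x)

/-- The space `L²(Ω; ℝ³) × L²(Ω; ℝ³)` with the Hilbert norm `(‖v‖² + ‖w‖²)^{1/2}`. A field `v` of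
`H(curl)` is represented by its graph element `(v, curl v)`, and the norm of this space restricted
to such pairs is the `H(curl)`-norm. -/
abbrev Pair (Ω : Set E3) : Type := WithLp 2 (L2 Ω × L2 Ω)

lemma pd_add {φ ψ : E3 → E3} (hφ : Differentiable ℝ φ) (hψ : Differentiable ℝ ψ) (i j : Fin 3)
    (x : E3) : pd (φ + ψ) i j x = pd φ i j x + pd ψ i j x := by
  simp [pd, fderiv_add (hφ x) (hψ x)]

lemma pd_smul {φ : E3 → E3} (hφ : Differentiable ℝ φ) (c : ℝ) (i j : Fin 3)
    (x : E3) : pd (c • φ) i j x = c * pd φ i j x := by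
  simp [pd, fderiv_const_smul (hφ x)]

lemma curl_add {φ ψ : E3 → E3} (hφ : Differentiable ℝ φ) (hψ : Differentiable ℝ ψ) (x : E3) :
    curl (φ + ψ) x = curl φ x + curl ψ x := by
  ext k
  fin_cases k <;> simp [curl, pd_add hφ hψ] <;> ring

lemma curl_smul {φ : E3 → E3} (hφ : Differentiable ℝ φ) (c : ℝ) (x : E3) :
    curl (c • φ) x = c • curl φ x := by
  ext k
  fin_cases k <;> simp [curl, pd_smul hφ] <;> ring

lemma IsTest.differentiable {Ω : Set E3} {φ : E3 → E3} (h : IsTest Ω φ) : Differentiable ℝ φ :=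
  h.smooth.differentiable (by simp)

/-- The graph elements `(φ, curl φ)` of the test fields `φ ∈ C₀^∞(Ω; ℝ³)`. -/
def testPairs (Ω : Set E3) : Submodule ℝ (Pair Ω) where
  carrier := {p | ∃ φ : E3 → E3, IsTest Ω φ ∧
    p.fst =ᵐ[volume.restrict Ω] φ ∧ p.snd =ᵐ[volume.restrict Ω] curl φ}
  zero_mem' := by
    refine ⟨0, ⟨contDiff_const, HasCompactSupport.zero, by simp [tsupport]⟩, ?_, ?_⟩
    · exact Lp.coeFn_zero _ _ _
    · have h : curl 0 = 0 := by
        funext x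
        ext k
        fin_cases k <;> simp [curl, pd]
      rw [h]
      exact Lp.coeFn_zero _ _ _
  add_mem' := by
    rintro p q ⟨φ, hφ, h1, h2⟩ ⟨ψ, hψ, h3, h4⟩
    refine ⟨φ + ψ, ⟨hφ.smooth.add hψ.smooth, hφ.compact.add hψ.compact,
      (tsupport_add φ ψ).trans (Set.union_subset hφ.supp hψ.supp)⟩, ?_, ?_⟩
    · filter_upwards [Lp.coeFn_add p.fst q.fst, h1, h3] with x hx h1 h3
      rw [WithLp.add_fst, hx, Pi.add_apply, h1, h3, Pi.add_apply]
    · filter_upwards [Lp.coeFn_add p.snd q.snd, h2, h4] with x hx h2 h4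
      rw [WithLp.add_snd, hx, Pi.add_apply, h2, h4,
        curl_add hφ.differentiable hψ.differentiable]
  smul_mem' := by
    rintro c p ⟨φ, hφ, h1, h2⟩
    refine ⟨c • φ, ⟨contDiff_const.smul hφ.smooth, hφ.compact.smul_left,
      (closure_mono (Function.support_const_smul_subset c φ)).trans hφ.supp⟩, ?_, ?_⟩
    · filter_upwards [Lp.coeFn_smul c p.fst, h1] with x hx h1
      rw [WithLp.smul_fst, hx, Pi.smul_apply, h1, Pi.smul_apply]
    · filter_upwards [Lp.coeFn_smul c p.snd, h2] with x hx h2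
      rw [WithLp.smul_snd, hx, Pi.smul_apply, h2, curl_smul hφ.differentiable]

/-- `H₀(curl)`: the closure of the test fields with respect to the `H(curl)`-norm, every field `v`
being represented by its graph element `(v, curl v)`. That the second component is indeed the
distributional curl of the first is `hasWeakCurl_fld_rot` below. -/
def H0curl (Ω : Set E3) : Submodule ℝ (Pair Ω) := (testPairs Ω).topologicalClosure

/-- The field `v ∈ L²(Ω; ℝ³)` of an element of `H₀(curl)`. -/
def fld {Ω : Set E3} (v : H0curl Ω) : L2 Ω := (v : Pair Ω).fst

/-- The distributional curl of an element of `H₀(curl)`. -/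
def rot {Ω : Set E3} (v : H0curl Ω) : L2 Ω := (v : Pair Ω).snd

lemma IsTest.hasCompactSupport_pd {Ω : Set E3} {φ : E3 → E3} (h : IsTest Ω φ) (i j : Fin 3) :
    HasCompactSupport (pd φ i j) := by
  have h1 := h.compact.fderiv (𝕜 := ℝ)
  exact h1.comp_left (g := fun A : E3 →L[ℝ] E3 => (A (EuclideanSpace.single i 1)) j) (by simp)

lemma IsTest.continuous_pd {Ω : Set E3} {φ : E3 → E3} (h : IsTest Ω φ) (i j : Fin 3) :
    Continuous (pd φ i j) := by
  have h1 : Continuous (fderiv ℝ φ) := h.smooth.continuous_fderiv (by simp)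
  unfold pd
  fun_prop

lemma integral_pd_mul {Ω : Set E3} {φ ψ : E3 → E3} (hφ : IsTest Ω φ) (hψ : IsTest Ω ψ)
    (i j k : Fin 3) : ∫ x, pd φ i j x * ψ x k = - ∫ x, φ x j * pd ψ i k x := by
  have comp : ∀ {χ : E3 → E3}, IsTest Ω χ → ∀ (l : Fin 3),
      Differentiable ℝ (fun x => χ x l) ∧ Continuous (fun x => χ x l) ∧
      HasCompactSupport (fun x => χ x l) ∧
      ∀ x, fderiv ℝ (fun x => χ x l) x (EuclideanSpace.single i 1) = pd χ i l x := by
    intro χ hχ l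
    have hd := hχ.differentiable
    refine ⟨by fun_prop, ?_, ?_, ?_⟩
    · have := hd.continuous
      fun_prop
    · exact hχ.compact.comp_left (g := fun y : E3 => y l) (by simp)
    · intro x
      have h1 : HasFDerivAt (fun x => χ x l)
          ((EuclideanSpace.proj l : E3 →L[ℝ] ℝ).comp (fderiv ℝ χ x)) x :=
        (EuclideanSpace.proj l : E3 →L[ℝ] ℝ).hasFDerivAt.comp x (hd x).hasFDerivAt
      rw [h1.fderiv]
      rfl
  obtain ⟨d1, c1, s1, e1⟩ := comp hφ j
  obtain ⟨d2, c2, s2, e2⟩ := comp hψ k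
  have key := integral_mul_fderiv_eq_neg_fderiv_mul_of_integrable (μ := (volume : Measure E3))
    (f := fun x => φ x j) (g := fun x => ψ x k) (v := EuclideanSpace.single i 1)
    (by
      simp only [e1]
      exact ((hφ.continuous_pd i j).mul c2).integrable_of_hasCompactSupport
        ((hφ.hasCompactSupport_pd i j).mul_right))
    (by
      simp only [e2]
      exact (c1.mul (hψ.continuous_pd i k)).integrable_of_hasCompactSupport s1.mul_right)
    ((c1.mul c2).integrable_of_hasCompactSupport s1.mul_right)
    (fun x _ => d1 x) (fun x _ => d2 x)
  simp only [e1, e2] at key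
  linarith

lemma IsTest.eq_zero {Ω : Set E3} {φ : E3 → E3} (h : IsTest Ω φ) {x : E3} (hx : x ∉ Ω) :
    φ x = 0 :=
  image_eq_zero_of_notMem_tsupport (fun h' => hx (h.supp h'))

lemma IsTest.continuous_curl {Ω : Set E3} {φ : E3 → E3} (h : IsTest Ω φ) :
    Continuous (curl φ) := by
  have := h.continuous_pd
  unfold curl
  fun_prop

lemma IsTest.hasCompactSupport_curl {Ω : Set E3} {φ : E3 → E3} (h : IsTest Ω φ) :
    HasCompactSupport (curl φ) := by
  have h1 := h.compact.fderiv (𝕜 := ℝ)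
  exact h1.comp_left (g := fun A : E3 →L[ℝ] E3 =>
    !₂[A (EuclideanSpace.single 1 1) 2 - A (EuclideanSpace.single 2 1) 1,
      A (EuclideanSpace.single 2 1) 0 - A (EuclideanSpace.single 0 1) 2,
      A (EuclideanSpace.single 0 1) 1 - A (EuclideanSpace.single 1 1) 0])
    (by ext k; fin_cases k <;> simp)

lemma integral_six {a b c d e f : E3 → ℝ} (ha : Integrable a) (hb : Integrable b)
    (hc : Integrable c) (hd : Integrable d) (he : Integrable e) (hf : Integrable f) :
    ∫ x, ((a x - b x) + (c x - d x)) + (e x - f x) =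
      (((∫ x, a x) - ∫ x, b x) + ((∫ x, c x) - ∫ x, d x)) + ((∫ x, e x) - ∫ x, f x) := by
  have h1 : ∫ x, ((a x - b x) + (c x - d x)) + (e x - f x) =
      (∫ x, (a x - b x) + (c x - d x)) + ∫ x, (e x - f x) :=
    integral_add ((ha.sub hb).add (hc.sub hd)) (he.sub hf)
  have h2 : ∫ x, (a x - b x) + (c x - d x) = (∫ x, (a x - b x)) + ∫ x, (c x - d x) :=
    integral_add (ha.sub hb) (hc.sub hd)
  rw [h1, h2, integral_sub ha hb, integral_sub hc hd, integral_sub he hf]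

/-- The classical curl of a test field is its distributional curl. -/
lemma IsTest.hasWeakCurl {Ω : Set E3} {φ : E3 → E3} (hφ : IsTest Ω φ) :
    HasWeakCurl Ω φ (curl φ) := by
  intro ψ hψ
  rw [setIntegral_eq_integral_of_forall_compl_eq_zero
      (fun x hx => by rw [hψ.eq_zero hx, inner_zero_right]),
    setIntegral_eq_integral_of_forall_compl_eq_zero
      (fun x hx => by rw [hφ.eq_zero hx, inner_zero_left])]
  have cψ : ∀ k, Continuous fun x => ψ x k := fun k => by
    have := hψ.differentiable.continuous
    fun_prop
  have cφ : ∀ k, Continuous fun x => φ x k := fun k => by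
    have := hφ.differentiable.continuous
    fun_prop
  have sφ : ∀ k, HasCompactSupport fun x => φ x k := fun k =>
    hφ.compact.comp_left (g := fun y : E3 => y k) (by simp)
  have I1 : ∀ i j k, Integrable fun x => pd φ i j x * ψ x k := fun i j k =>
    ((hφ.continuous_pd i j).mul (cψ k)).integrable_of_hasCompactSupport
      (hφ.hasCompactSupport_pd i j).mul_right
  have I2 : ∀ i j k, Integrable fun x => φ x j * pd ψ i k x := fun i j k =>
    ((cφ j).mul (hψ.continuous_pd i k)).integrable_of_hasCompactSupport (sφ j).mul_right
  have e1 : ∀ x, inner ℝ (curl φ x) (ψ x) =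
      ((pd φ 1 2 x * ψ x 0 - pd φ 2 1 x * ψ x 0) + (pd φ 2 0 x * ψ x 1 - pd φ 0 2 x * ψ x 1))
        + (pd φ 0 1 x * ψ x 2 - pd φ 1 0 x * ψ x 2) := fun x => by
    simp [curl, PiLp.inner_apply, Fin.sum_univ_three]
    ring
  have e2 : ∀ x, inner ℝ (φ x) (curl ψ x) =
      ((φ x 0 * pd ψ 1 2 x - φ x 0 * pd ψ 2 1 x) + (φ x 1 * pd ψ 2 0 x - φ x 1 * pd ψ 0 2 x))
        + (φ x 2 * pd ψ 0 1 x - φ x 2 * pd ψ 1 0 x) := fun x => by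
    simp [curl, PiLp.inner_apply, Fin.sum_univ_three]
    ring
  simp only [e1, e2]
  rw [integral_six (I1 _ _ _) (I1 _ _ _) (I1 _ _ _) (I1 _ _ _) (I1 _ _ _) (I1 _ _ _),
    integral_six (I2 _ _ _) (I2 _ _ _) (I2 _ _ _) (I2 _ _ _) (I2 _ _ _) (I2 _ _ _)]
  simp only [integral_pd_mul hφ hψ]
  ring

/-- For `v ∈ H₀(curl)`, the second component of the graph element is the distributional curl of
the first one; in particular it is determined by it. -/
theorem hasWeakCurl_fld_rot {Ω : Set E3} (v : H0curl Ω) :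
    HasWeakCurl Ω (fld v) (rot v) := by
  intro ψ hψ
  have m1 : MemLp ψ 2 (volume.restrict Ω) :=
    (hψ.differentiable.continuous.memLp_of_hasCompactSupport hψ.compact)
  have m2 : MemLp (curl ψ) 2 (volume.restrict Ω) :=
    (hψ.continuous_curl.memLp_of_hasCompactSupport hψ.hasCompactSupport_curl)
  have t : ∀ (p : L2 Ω) {χ : E3 → E3} (m : MemLp χ 2 (volume.restrict Ω)),
      inner ℝ p (m.toLp χ) = ∫ x in Ω, inner ℝ (p x) (χ x) := by
    intro p χ m
    rw [L2.inner_def]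
    refine integral_congr_ae ?_
    filter_upwards [m.coeFn_toLp] with x hx
    rw [hx]
  have hcl : IsClosed {p : Pair Ω | inner ℝ p.snd (m1.toLp ψ) = inner ℝ p.fst (m2.toLp (curl ψ))} :=
    isClosed_eq
      (((WithLp.sndL 2 ℝ (L2 Ω) (L2 Ω)).continuous).inner continuous_const)
      (((WithLp.fstL 2 ℝ (L2 Ω) (L2 Ω)).continuous).inner continuous_const)
  have hmem := closure_minimal (s := (testPairs Ω : Set (Pair Ω))) (fun p hp => by
    obtain ⟨φ, hφ, h1, h2⟩ := hp
    show inner ℝ p.snd (m1.toLp ψ) = inner ℝ p.fst (m2.toLp (curl ψ))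
    rw [t, t]
    have := hφ.hasWeakCurl ψ hψ
    rw [integral_congr_ae (g := fun x => inner ℝ (curl φ x) (ψ x)) (by
        filter_upwards [h2] with x hx
        rw [hx]), this]
    refine integral_congr_ae ?_
    filter_upwards [h1] with x hx
    rw [hx]) hcl v.2
  have := hmem
  simp only [Set.mem_ofPred_eq, t] at this
  exact this

/-- The functional `v ↦ ∫_Ω λ · v dx` on `H₀(curl)` given by `λ ∈ L²(Ω; ℝ³)`, as an element of the
dual space `H₀(curl)*` (which carries the operator norm). -/
def toDual {Ω : Set E3} (lam : L2 Ω) : H0curl Ω →L[ℝ] ℝ :=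
  (innerSL ℝ lam).comp ((WithLp.fstL 2 ℝ (L2 Ω) (L2 Ω)).comp (H0curl Ω).subtypeL)

/-! ### Lipschitz sets -/

/-- Near its boundary point `x`, the set `U` is the strict epigraph of an `L`-Lipschitz function, in
the open cylinder of radius `r` and half-height `h` centred at `x`, with respect to some orthonormal
coordinate system centred at `x`. -/
def IsGraphNear (L : ℝ≥0) (r h : ℝ) (U : Set E3) (x : E3) : Prop :=
  ∃ (R : E3 ≃ₗᵢ[ℝ] E3) (g : EuclideanSpace ℝ (Fin 2) → ℝ), LipschitzWith L g ∧ g 0 = 0 ∧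
    ∀ y : E3, ‖(!₂[y 0, y 1] : EuclideanSpace ℝ (Fin 2))‖ < r → |y 2| < h →
      (x + R y ∈ U ↔ g !₂[y 0, y 1] < y 2)

/-- Bounded Lipschitz domain. -/
structure IsLipschitzDomain (U : Set E3) : Prop where
  isOpen : IsOpen U
  isConnected : IsConnected U
  isBounded : Bornology.IsBounded U
  graph : ∀ x ∈ frontier U, ∃ (L : ℝ≥0) (r h : ℝ), 0 < r ∧ 0 < h ∧ IsGraphNear L r h U x

/-- The admissible shapes: open subsets of `B` that are uniformly Lipschitz, i.e. all the local
boundary graphs have Lipschitz constant `L`, over cylinders of a common size `(r, h)`. -/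
def Shapes (B : Set E3) (L : ℝ≥0) (r h : ℝ) : Set (Set E3) :=
  {ω | ω ⊆ B ∧ IsOpen ω ∧ ∀ x ∈ frontier ω, IsGraphNear L r h ω x}

/-- Hausdorff convergence of (uniformly bounded) open sets: the complements converge with respect to
the Hausdorff distance. -/
def HausdorffConv (ω : ℕ → Set E3) (ω' : Set E3) : Prop :=
  Tendsto (fun k => Metric.hausdorffEDist (ω k)ᶜ ω'ᶜ) atTop (𝓝 0)

/-- Convergence in the sense of characteristic functions: `χ_{ω_k} → χ_{ω'}` in `L^p(ℝ³)` for every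
`p ∈ [1, ∞)`. -/
def CharConv (ω : ℕ → Set E3) (ω' : Set E3) : Prop :=
  ∀ p : ℝ≥0∞, 1 ≤ p → p ≠ ∞ →
    Tendsto (fun k => eLpNorm ((ω k).indicator (fun _ => (1 : ℝ)) - ω'.indicator (fun _ => (1 : ℝ)))
      p volume) atTop (𝓝 0)

/-! ### Data of the problem -/

/-- `u` belongs to the Banach space `C¹(B)` on the open set `B`: it is continuously differentiable
on `B`, and bounded there together with its derivative. -/
def IsC1 {F : Type*} [NormedAddCommGroup F] [NormedSpace ℝ F] (B : Set E3) (u : E3 → F) : Prop :=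
  ContDiffOn ℝ 1 u B ∧ ∃ C : ℝ, ∀ x ∈ B, ‖u x‖ ≤ C ∧ ‖fderiv ℝ u x‖ ≤ C

/-- A material tensor: in `L^∞(Ω; ℝ^{3×3}) ∩ C¹(B; ℝ^{3×3})`, symmetric and uniformly positive
definite. -/
structure IsMaterial (Ω B : Set E3) (M : E3 → Matrix (Fin 3) (Fin 3) ℝ) : Prop where
  bounded : ∀ i j, MemLp (fun x => M x i j) ∞ (volume.restrict Ω)
  c1 : ∀ i j, IsC1 B (fun x => M x i j)
  symm : ∀ᵐ x ∂volume.restrict Ω, (M x).IsSymm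
  posDef : ∃ c : ℝ, 0 < c ∧ ∀ᵐ x ∂volume.restrict Ω, ∀ ξ : E3,
    c * ‖ξ‖ ^ 2 ≤ inner ℝ ξ (Matrix.toEuclideanLin (M x) ξ)

/-- The data: the domain `Ω`, the subset `B`, the target `Ed`, the weight `κ`, the critical current
density `jc`, the permittivity `ε`, the reluctivity `ν` and the applied current source `f`. -/
structure Data where
  Ω : Set E3
  B : Set E3
  Ed : E3 → E3
  κ : E3 → ℝ
  jc : ℝ
  ε : E3 → Matrix (Fin 3) (Fin 3) ℝ
  ν : E3 → Matrix (Fin 3) (Fin 3) ℝ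
  f : E3 → E3

/-- The standing assumptions on the data. -/
structure Data.Admissible (D : Data) : Prop where
  domain : IsLipschitzDomain D.Ω
  subset : D.B ⊆ D.Ω
  lipB : IsLipschitzDomain D.B
  target : IsC1 D.B D.Ed
  weight : IsC1 D.B D.κ
  weight_pos : ∀ x ∈ D.B, 0 < D.κ x
  jc_pos : 0 < D.jc
  permittivity : IsMaterial D.Ω D.B D.ε
  reluctivity : IsMaterial D.Ω D.B D.ν
  source : MemLp D.f 2 (volume.restrict D.Ω)
  source_c1 : IsC1 D.B D.f

/-- The regularized maximum `max_γ {1, x}`. -/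
def regMax (γ x : ℝ) : ℝ :=
  if 1 / (2 * γ) ≤ x - 1 then x
  else if |x - 1| ≤ 1 / (2 * γ) then 1 + γ / 2 * (x - 1 + 1 / (2 * γ)) ^ 2
  else 1

namespace Data

variable (D : Data)

/-- The bilinear form `a(v, w) = ∫_Ω ν curl v · curl w dx + ∫_Ω ε v · w dx`. -/
def a (v w : H0curl D.Ω) : ℝ :=
  (∫ x in D.Ω, inner ℝ (Matrix.toEuclideanLin (D.ν x) (rot v x)) (rot w x)) +
    ∫ x in D.Ω, inner ℝ (Matrix.toEuclideanLin (D.ε x) (fld v x)) (fld w x)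

/-- The load `∫_Ω f · v dx`. -/
def load (v : H0curl D.Ω) : ℝ := ∫ x in D.Ω, inner ℝ (D.f x) (fld v x)

/-- The nonsmooth functional `φ_ω(v) = j_c ∫_ω |v| dx`. -/
def phi (ω : Set E3) (v : H0curl D.Ω) : ℝ := D.jc * ∫ x in ω, ‖fld v x‖

/-- `E` solves the variational inequality for the shape `ω`. -/
def IsState (ω : Set E3) (E : H0curl D.Ω) : Prop :=
  ∀ v : H0curl D.Ω, D.load (v - E) ≤ D.a E (v - E) + D.phi ω v - D.phi ω E

/-- `lam ∈ L²(Ω; ℝ³)` is extended by zero outside of `ω`. -/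
def IsZeroExt (ω : Set E3) (lam : L2 D.Ω) : Prop :=
  ∀ᵐ x ∂volume.restrict (D.Ω \ ω), lam x = 0

/-- `(E, lam)` solves the dual formulation of the variational inequality for the shape `ω`; the
multiplier is extended by zero to `Ω`. -/
structure IsDualSol (ω : Set E3) (E : H0curl D.Ω) (lam : L2 D.Ω) : Prop where
  zeroExt : D.IsZeroExt ω lam
  eqn : ∀ v : H0curl D.Ω, D.a E v + ∫ x in ω, inner ℝ (lam x) (fld v x) = D.load v
  bound : ∀ᵐ x ∂volume.restrict ω, ‖lam x‖ ≤ D.jc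
  align : ∀ᵐ x ∂volume.restrict ω, inner ℝ (lam x) (fld E x) = D.jc * ‖fld E x‖

/-- `(E, lam)` solves the penalized dual formulation with parameter `γ` for the shape `ω`; the
multiplier is extended by zero to `Ω`. -/
structure IsPenSol (γ : ℝ) (ω : Set E3) (E : H0curl D.Ω) (lam : L2 D.Ω) : Prop where
  zeroExt : D.IsZeroExt ω lam
  eqn : ∀ v : H0curl D.Ω, D.a E v + ∫ x in ω, inner ℝ (lam x) (fld v x) = D.load v
  law : ∀ᵐ x ∂volume.restrict ω,
    lam x = (D.jc * γ / regMax γ (γ * ‖fld E x‖)) • fld E x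

/-- The cost `½ ∫_B κ |E - Ed|² dx + ∫_ω dx` of a shape `ω` and an electric field `E`. -/
def cost (ω : Set E3) (E : H0curl D.Ω) : ℝ :=
  1 / 2 * (∫ x in D.B, D.κ x * ‖fld E x - D.Ed x‖ ^ 2) + ∫ _x in ω, (1 : ℝ)

/-- `ω` is an optimal shape of the original problem: it minimizes the cost of `(ω, E(ω))` over the
class `O` of shapes, `E(ω)` being the solution of the variational inequality. -/
def IsOptimal (O : Set (Set E3)) (ω : Set E3) : Prop :=
  ω ∈ O ∧ ∃ E, D.IsState ω E ∧ ∀ ω' ∈ O, ∀ E', D.IsState ω' E' → D.cost ω E ≤ D.cost ω' E'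

/-- `ω` is an optimal shape of the penalized problem: it minimizes the cost of `(ω, E^γ(ω))` over
the class `O` of shapes, `E^γ(ω)` being the solution of the penalized dual formulation. -/
def IsPenOptimal (γ : ℝ) (O : Set (Set E3)) (ω : Set E3) : Prop :=
  ω ∈ O ∧ ∃ E lam, D.IsPenSol γ ω E lam ∧
    ∀ ω' ∈ O, ∀ E' lam', D.IsPenSol γ ω' E' lam' → D.cost ω E ≤ D.cost ω' E'

end Data

end HTS

end

/-!
A solution of the penalized problem solves the variational inequality of `(P)` up to an error of
order `1 / γ`. Testing two such approximate inequalities, for shapes `ω` and `ω'`, with each other's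
solutions and using the coercivity of `a` gives
`c |E - E'|² ≤ δ + δ' + j_c |ω ∆ ω'|^{1/2} |E - E'|`. Hence the penalized states for a fixed shape
form a Cauchy family, whose limit is `E(ω)`, and states follow the convergence of shapes in measure.

For the shapes, isometries and Lipschitz graphs with a common constant converge pointwise along
ultrafilters, so a Hausdorff limit of uniformly Lipschitz sets is again one. Its boundary is locally
a graph, hence null, and away from it membership is eventually constant; this gives convergence in
measure. Optimality of the limit is obtained by passing to the limit in `J_γ(ω^γ) ≤ J_γ(ω₀)` for a
fixed competitor `ω₀`.

The functional `v ↦ f(v) - a(E, v)` is bounded by `j_c ∫_ω |v|`, so it has a Hahn-Banach extension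
to `L¹`, and `λ` is its density. As a functional `λ = f - a(E, ·)`, so its dual norm is
controlled by the states.
-/

noncomputable section

namespace HTS

/-! ### Hausdorff limits of complements -/

lemma exists_mem_frontier_of_isPreconnected {X : Type*} [TopologicalSpace X] {s U : Set X}
    (hs : IsPreconnected s) {p z : X} (hps : p ∈ s) (hp : p ∈ U) (hzs : z ∈ s) (hz : z ∉ U) :
    ∃ q ∈ s, q ∈ frontier U := by
  by_contra! hcon
  have hint : ∀ q ∈ s, q ∈ closure U → q ∈ interior U := fun q hqs hq =>
    not_not.1 fun hq' => hcon q hqs ⟨hq, hq'⟩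
  have hsub : s ⊆ interior U := hs.subset_of_closure_inter_subset isOpen_interior
    ⟨p, hps, hint p hps (subset_closure hp)⟩
    fun q hq => hint q hq.2 (closure_mono interior_subset hq.1)
  exact hz (interior_subset (hsub hzs))

section HausdorffLimit

variable {ι X : Type*} {l : Filter ι} {U : ι → Set X} {V : Set X} {x : X}

lemma eventually_mem_of_hausdorffEDist_compl [PseudoEMetricSpace X] (hV : IsOpen V)
    (hU : Tendsto (fun i => Metric.hausdorffEDist (U i)ᶜ Vᶜ) l (𝓝 0)) (hx : x ∈ V) :
    ∀ᶠ q in l ×ˢ 𝓝 x, q.2 ∈ U q.1 := by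
  obtain ⟨δ, hδ, hball⟩ := EMetric.isOpen_iff.1 hV x hx
  have hδ2 : 0 < δ / 2 := ENNReal.half_pos hδ.ne'
  filter_upwards [(hU.eventually_lt_const hδ2).prod_mk (Metric.eball_mem_nhds x hδ2)]
    with q ⟨hq, hqx⟩
  by_contra hqU
  obtain ⟨z, hz, hqz⟩ := Metric.exists_edist_lt_of_hausdorffEDist_lt (x := q.2) hqU hq
  refine hz (hball ?_)
  calc edist z x ≤ edist q.2 z + edist q.2 x := edist_triangle_left z x q.2
    _ < δ / 2 + δ / 2 := ENNReal.add_lt_add hqz hqx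
    _ = δ := ENNReal.add_halves δ

lemma eventually_exists_notMem_of_hausdorffEDist_compl [PseudoEMetricSpace X]
    (hU : Tendsto (fun i => Metric.hausdorffEDist (U i)ᶜ Vᶜ) l (𝓝 0)) (hx : x ∉ V) {s : Set X}
    (hs : s ∈ 𝓝 x) : ∀ᶠ i in l, ∃ z ∈ s, z ∉ U i := by
  obtain ⟨δ, hδ, hball⟩ := EMetric.mem_nhds_iff.1 hs
  filter_upwards [hU.eventually_lt_const hδ] with i hi
  rw [Metric.hausdorffEDist_comm] at hi
  obtain ⟨z, hz, hxz⟩ := Metric.exists_edist_lt_of_hausdorffEDist_lt hx hi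
  exact ⟨z, hball (by rwa [Metric.mem_eball, edist_comm]), hz⟩

lemma frequently_notMem_of_hausdorffEDist_compl [PseudoEMetricSpace X] [NeBot l]
    (hU : Tendsto (fun i => Metric.hausdorffEDist (U i)ᶜ Vᶜ) l (𝓝 0)) (hx : x ∉ V) :
    ∃ᶠ q in l ×ˢ 𝓝 x, q.2 ∉ U q.1 := by
  intro hmem
  obtain ⟨pa, ha, pb, hb, h⟩ := eventually_prod_iff.1 hmem
  obtain ⟨i, ⟨z, hz, hzU⟩, hi⟩ :=
    ((eventually_exists_notMem_of_hausdorffEDist_compl hU hx hb).and ha).exists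
  exact h hi hz hzU

lemma frequently_mem_of_mem_closure [PseudoEMetricSpace X] [NeBot l] (hV : IsOpen V)
    (hU : Tendsto (fun i => Metric.hausdorffEDist (U i)ᶜ Vᶜ) l (𝓝 0)) (hx : x ∈ closure V) :
    ∃ᶠ q in l ×ˢ 𝓝 x, q.2 ∈ U q.1 := by
  intro hnot
  obtain ⟨pa, ha, pb, hb, h⟩ := eventually_prod_iff.1 hnot
  obtain ⟨z, hz, hzV⟩ := mem_closure_iff_nhds.1 hx _ (eventually_eventually_nhds.2 hb)
  obtain ⟨⟨i, w⟩, hiw, hi, hw⟩ := ((eventually_mem_of_hausdorffEDist_compl hV hU hzV).and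
    (ha.prod_mk hz)).exists
  exact h hi hw hiw

lemma subset_of_hausdorffEDist_compl [PseudoEMetricSpace X] [NeBot l] {B : Set X} (hV : IsOpen V)
    (hU : Tendsto (fun i => Metric.hausdorffEDist (U i)ᶜ Vᶜ) l (𝓝 0)) (hB : ∀ i, U i ⊆ B) :
    V ⊆ B := by
  intro x hx
  obtain ⟨i, hi⟩ := (eventually_mem_of_hausdorffEDist_compl hV hU hx).curry.exists
  exact hB i (mem_of_mem_nhds hi)

lemma frequently_mem_frontier_of_hausdorffEDist_compl [SeminormedAddCommGroup X]
    [NormedSpace ℝ X] (hU : Tendsto (fun i => Metric.hausdorffEDist (U i)ᶜ Vᶜ) l (𝓝 0))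
    (hx : x ∉ V) (hxU : ∃ᶠ q in l ×ˢ 𝓝 x, q.2 ∈ U q.1) :
    ∃ᶠ q in l ×ˢ 𝓝 x, q.2 ∈ frontier (U q.1) := by
  intro hnot
  obtain ⟨pa, ha, pb, hb, h⟩ := eventually_prod_iff.1 hnot
  obtain ⟨δ, hδ, hball⟩ := Metric.eventually_nhds_iff_ball.1 hb
  have hδx : Metric.ball x δ ∈ 𝓝 x := Metric.ball_mem_nhds x hδ
  obtain ⟨⟨i, p⟩, hp, ⟨hi, z, hz, hzU⟩, hpx⟩ := (hxU.and_eventually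
    ((ha.and (eventually_exists_notMem_of_hausdorffEDist_compl hU hx hδx)).prod_mk hδx)).exists
  obtain ⟨q, hq, hqU⟩ := exists_mem_frontier_of_isPreconnected
    (convex_ball x δ).isPreconnected hpx hp hz hzU
  exact h hi (hball q hq) hqU

end HausdorffLimit

/-! ### Limits of local graph representations -/

/-- The horizontal part `y' = (y₁, y₂)` of a point `y = (y', y₃)` of `ℝ³`. -/
def horiz : E3 →L[ℝ] EuclideanSpace ℝ (Fin 2) :=
  LinearMap.toContinuousLinearMap
    { toFun := fun y => !₂[y 0, y 1]
      map_add' := fun y z => by ext i; fin_cases i <;> simp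
      map_smul' := fun c y => by ext i; fin_cases i <;> simp }

/-- The open cylinder `{|y'| < r, |y₃| < h}` in local coordinates. -/
def cylinder (r h : ℝ) : Set E3 := {y | ‖horiz y‖ < r ∧ |y 2| < h}

/-- In the cylinder of size `(r, h)` of the coordinate system with axes `R` centred at `x`, the set
`U` is the strict epigraph of `g`. -/
def IsEpigraphIn (r h : ℝ) (R : E3 ≃ₗᵢ[ℝ] E3) (g : EuclideanSpace ℝ (Fin 2) → ℝ) (U : Set E3)
    (x : E3) : Prop :=
  ∀ y ∈ cylinder r h, x + R y ∈ U ↔ g (horiz y) < y 2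

lemma isGraphNear_iff {L : ℝ≥0} {r h : ℝ} {U : Set E3} {x : E3} :
    IsGraphNear L r h U x ↔ ∃ (R : E3 ≃ₗᵢ[ℝ] E3) (g : EuclideanSpace ℝ (Fin 2) → ℝ),
      LipschitzWith L g ∧ g 0 = 0 ∧ IsEpigraphIn r h R g U x := by
  simp only [IsEpigraphIn, cylinder, Set.mem_ofPred_eq, and_imp]
  rfl

/-- The point of `ℝ³` lying `t` above `y`. -/
def lift (y : E3) (t : ℝ) : E3 := y + t • EuclideanSpace.single 2 1

lemma continuous_lift (y : E3) : Continuous (lift y) := by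
  unfold lift
  fun_prop

@[simp] lemma lift_zero (y : E3) : lift y 0 = y := by simp [lift]

@[simp] lemma horiz_lift (y : E3) (t : ℝ) : horiz (lift y t) = horiz y := by
  ext i
  fin_cases i <;> simp [horiz, lift]

@[simp] lemma lift_apply_two (y : E3) (t : ℝ) : lift y t 2 = y 2 + t := by
  simp [lift]

lemma isOpen_cylinder (r h : ℝ) : IsOpen (cylinder r h) :=
  (isOpen_lt (f := fun y => ‖horiz y‖) (by fun_prop) continuous_const).inter
    (isOpen_lt (f := fun y : E3 => |y 2|) (by fun_prop) continuous_const)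

lemma zero_mem_cylinder {r h : ℝ} (hr : 0 < r) (hh : 0 < h) : (0 : E3) ∈ cylinder r h := by
  simp [cylinder, hr, hh]

lemma IsEpigraphIn.mem_closure {r h : ℝ} (hr : 0 < r) (hh : 0 < h) {R : E3 ≃ₗᵢ[ℝ] E3}
    {g : EuclideanSpace ℝ (Fin 2) → ℝ} (g0 : g 0 = 0) {U : Set E3} {x : E3}
    (H : IsEpigraphIn r h R g U x) : x ∈ closure U := by
  have hcont : Tendsto (lift 0) (𝓝[>] 0) (𝓝 0) := by
    simpa using ((continuous_lift 0).tendsto 0).mono_left nhdsWithin_le_nhds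
  have hlim : Tendsto (fun t => x + R (lift 0 t)) (𝓝[>] 0) (𝓝 x) := by
    simpa using ((R.continuous.tendsto 0).comp hcont).const_add x
  refine mem_closure_of_tendsto hlim ?_
  filter_upwards [hcont ((isOpen_cylinder r h).mem_nhds (zero_mem_cylinder hr hh)),
    self_mem_nhdsWithin] with t htc ht
  rw [H _ htc]
  simpa [g0] using ht

lemma exists_tendsto_linearIsometryEquiv {κ E : Type*} [NormedAddCommGroup E] [NormedSpace ℝ E]
    [FiniteDimensional ℝ E] (u : Ultrafilter κ) (R : κ → E ≃ₗᵢ[ℝ] E) :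
    ∃ R' : E ≃ₗᵢ[ℝ] E, ∀ v, Tendsto (fun i => R i v) u (𝓝 (R' v)) := by
  have hR : ∀ i, (R i : E →L[ℝ] E) ∈ Metric.closedBall 0 1 := fun i => by
    rw [mem_closedBall_zero_iff]
    exact (R i).toLinearIsometry.norm_toContinuousLinearMap_le
  obtain ⟨A, -, hA⟩ := (isCompact_closedBall (0 : E →L[ℝ] E) 1).ultrafilter_le_nhds'
    (u.map fun i => (R i : E →L[ℝ] E)) (Ultrafilter.mem_map.2 (univ_mem' hR))
  have hAv : ∀ v, Tendsto (fun i => R i v) u (𝓝 (A v)) := fun v =>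
    ((ContinuousLinearMap.apply ℝ E v).continuous.tendsto A).comp hA
  have hnorm : ∀ v, ‖A v‖ = ‖v‖ := fun v =>
    tendsto_nhds_unique (hAv v).norm (by simp)
  exact ⟨LinearIsometry.toLinearIsometryEquiv ⟨A, hnorm⟩ rfl, hAv⟩

lemma exists_tendsto_lipschitzWith {κ X Y : Type*} [PseudoMetricSpace X] [MetricSpace Y]
    [ProperSpace Y] {K : ℝ≥0} (u : Ultrafilter κ) {g : κ → X → Y} {a : X} {b : Y}
    (hg : ∀ᶠ i in u, LipschitzWith K (g i)) (hab : ∀ᶠ i in u, g i a = b) :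
    ∃ g' : X → Y, LipschitzWith K g' ∧ g' a = b ∧ ∀ v, Tendsto (fun i => g i v) u (𝓝 (g' v)) := by
  have hlim : ∀ v, ∃ c, Tendsto (fun i => g i v) u (𝓝 c) := fun v => by
    have hmem : ∀ᶠ i in u, g i v ∈ Metric.closedBall b (K * dist v a) := by
      filter_upwards [hg, hab] with i hi hi'
      simpa only [hi', Metric.mem_closedBall] using hi.dist_le_mul v a
    obtain ⟨c, -, hc⟩ := (isCompact_closedBall b (K * dist v a)).ultrafilter_le_nhds'
      (u.map fun i => g i v) hmem
    exact ⟨c, hc⟩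
  choose g' hg' using hlim
  refine ⟨g', LipschitzWith.of_dist_le_mul fun v w => ?_, ?_, hg'⟩
  · exact le_of_tendsto ((hg' v).dist (hg' w)) (hg.mono fun i hi => hi.dist_le_mul v w)
  · exact tendsto_nhds_unique (hg' a) (tendsto_const_nhds.congr' (hab.mono fun i hi => hi.symm))

lemma tendsto_apply_of_lipschitzWith {κ X Y : Type*} [PseudoMetricSpace X] [PseudoMetricSpace Y]
    {K : ℝ≥0} {l : Filter κ} {g : κ → X → Y} {w : κ → X} {w' : X} {b : Y}
    (hg : ∀ᶠ i in l, LipschitzWith K (g i)) (hw : Tendsto w l (𝓝 w'))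
    (hgw : Tendsto (fun i => g i w') l (𝓝 b)) : Tendsto (fun i => g i (w i)) l (𝓝 b) := by
  refine (tendsto_iff_of_dist ?_).1 hgw
  refine squeeze_zero' (Eventually.of_forall fun i => dist_nonneg)
    (hg.mono fun i hi => hi.dist_le_mul w' (w i)) ?_
  simpa using ((tendsto_const_nhds (x := w')).dist hw).const_mul (K : ℝ)

section EpigraphLimit

variable {κ : Type*} {l : Filter κ} [NeBot l] {U : κ → Set E3} {V : Set E3} {x : κ → E3} {x' : E3}
  {R : κ → E3 ≃ₗᵢ[ℝ] E3} {R' : E3 ≃ₗᵢ[ℝ] E3} {g : κ → EuclideanSpace ℝ (Fin 2) → ℝ}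
  {g' : EuclideanSpace ℝ (Fin 2) → ℝ} {r h : ℝ}

lemma lt_of_mem_of_tendsto_isEpigraphIn (hV : IsOpen V)
    (hU : Tendsto (fun i => Metric.hausdorffEDist (U i)ᶜ Vᶜ) l (𝓝 0)) (hx : Tendsto x l (𝓝 x'))
    (hR : ∀ v, Tendsto (fun i => R i v) l (𝓝 (R' v)))
    (hg : ∀ v, Tendsto (fun i => g i v) l (𝓝 (g' v)))
    (H : ∀ᶠ i in l, IsEpigraphIn r h (R i) (g i) (U i) (x i)) {y : E3} (hy : y ∈ cylinder r h)
    (hyV : x' + R' y ∈ V) : g' (horiz y) < y 2 := by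
  have hlift : Tendsto (lift y) (𝓝[<] 0) (𝓝 y) := by
    simpa using ((continuous_lift y).tendsto 0).mono_left nhdsWithin_le_nhds
  have hlift' : Tendsto (fun t => x' + R' (lift y t)) (𝓝[<] 0) (𝓝 (x' + R' y)) :=
    ((R'.continuous.tendsto y).comp hlift).const_add x'
  obtain ⟨t, htc, htV, ht⟩ := ((hlift.eventually_mem ((isOpen_cylinder r h).mem_nhds hy)).and
    ((hlift'.eventually_mem (hV.mem_nhds hyV)).and self_mem_nhdsWithin)).exists
  have hmem : ∀ᶠ i in l, x i + R i (lift y t) ∈ U i :=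
    (tendsto_id.prodMk (hx.add (hR (lift y t)))).eventually
      (eventually_mem_of_hausdorffEDist_compl hV hU htV)
  have hle : g' (horiz y) ≤ y 2 + t := by
    refine le_of_tendsto (hg (horiz y)) ?_
    filter_upwards [hmem, H] with i hi hi'
    simpa using ((hi' _ htc).1 hi).le
  exact hle.trans_lt (add_lt_of_neg_right _ ht)

lemma mem_of_lt_of_tendsto_isEpigraphIn {L : ℝ≥0}
    (hU : Tendsto (fun i => Metric.hausdorffEDist (U i)ᶜ Vᶜ) l (𝓝 0)) (hx : Tendsto x l (𝓝 x'))
    (hR : ∀ v, Tendsto (fun i => R i v) l (𝓝 (R' v)))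
    (hL : ∀ᶠ i in l, LipschitzWith L (g i)) (hg : ∀ v, Tendsto (fun i => g i v) l (𝓝 (g' v)))
    (H : ∀ᶠ i in l, IsEpigraphIn r h (R i) (g i) (U i) (x i)) {y : E3} (hy : y ∈ cylinder r h)
    (hyg : g' (horiz y) < y 2) : x' + R' y ∈ V := by
  by_contra hyV
  have hfst : Tendsto Prod.fst (l ×ˢ 𝓝 (x' + R' y)) l := tendsto_fst
  let w : κ × E3 → E3 := fun q => (R q.1).symm (q.2 - x q.1)
  have hRw : ∀ q, x q.1 + R q.1 (w q) = q.2 := fun q => by simp [w]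
  have hw : Tendsto w (l ×ˢ 𝓝 (x' + R' y)) (𝓝 y) := by
    refine tendsto_iff_dist_tendsto_zero.2 ?_
    have hdist : ∀ q, dist (w q) y = dist q.2 (x q.1 + R q.1 y) := fun q => by
      rw [← (R q.1).dist_map, ← dist_add_left (x q.1), hRw]
    simp only [hdist]
    simpa using tendsto_snd.dist ((hx.comp hfst).add ((hR y).comp hfst))
  have hgw : Tendsto (fun q => g q.1 (horiz (w q))) (l ×ˢ 𝓝 (x' + R' y)) (𝓝 (g' (horiz y))) :=
    tendsto_apply_of_lipschitzWith (hfst.eventually hL) ((horiz.continuous.tendsto y).comp hw)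
      ((hg _).comp hfst)
  have hw2 : Tendsto (fun q => w q 2) (l ×ˢ 𝓝 (x' + R' y)) (𝓝 (y 2)) :=
    ((continuous_apply 2).comp (PiLp.continuous_ofLp 2 _)).continuousAt.tendsto.comp hw
  refine frequently_notMem_of_hausdorffEDist_compl hU hyV ?_
  filter_upwards [hw ((isOpen_cylinder r h).mem_nhds hy), hgw.eventually_lt hw2 hyg,
    hfst.eventually H] with q hqc hqg hqH
  rw [not_not, ← hRw q]
  exact (hqH _ hqc).2 hqg

end EpigraphLimit

theorem IsGraphNear.of_frequently {ι : Type*} {l : Filter ι} {U : ι → Set E3} {V : Set E3} {x : E3}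
    {L : ℝ≥0} {r h : ℝ} (hV : IsOpen V)
    (hU : Tendsto (fun i => Metric.hausdorffEDist (U i)ᶜ Vᶜ) l (𝓝 0))
    (H : ∃ᶠ q in l ×ˢ 𝓝 x, IsGraphNear L r h (U q.1) q.2) : IsGraphNear L r h V x := by
  have : NeBot ((l ×ˢ 𝓝 x) ⊓ 𝓟 {q | IsGraphNear L r h (U q.1) q.2}) :=
    frequently_mem_iff_neBot.1 H
  obtain ⟨u, hu⟩ := Ultrafilter.exists_le ((l ×ˢ 𝓝 x) ⊓ 𝓟 {q | IsGraphNear L r h (U q.1) q.2})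
  have hfst : Tendsto Prod.fst u l := (tendsto_fst (g := 𝓝 x)).mono_left (hu.trans inf_le_left)
  have hsnd : Tendsto Prod.snd u (𝓝 x) := (tendsto_snd (f := l)).mono_left (hu.trans inf_le_left)
  have hgraph : ∀ᶠ q : ι × E3 in u, IsGraphNear L r h (U q.1) q.2 :=
    hu (mem_inf_of_right (mem_principal_self _))
  simp only [isGraphNear_iff] at hgraph
  obtain ⟨R, hR⟩ := hgraph.choice
  obtain ⟨g, hg⟩ := hR.choice
  obtain ⟨R', hR'⟩ := exists_tendsto_linearIsometryEquiv u R
  obtain ⟨g', hgL, hg0, hg'⟩ := exists_tendsto_lipschitzWith u (hg.mono fun q hq => hq.1)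
    (hg.mono fun q hq => hq.2.1)
  exact isGraphNear_iff.2 ⟨R', g', hgL, hg0, fun y hy =>
    ⟨lt_of_mem_of_tendsto_isEpigraphIn hV (hU.comp hfst) hsnd hR' hg'
      (hg.mono fun q hq => hq.2.2) hy,
    mem_of_lt_of_tendsto_isEpigraphIn (hU.comp hfst) hsnd hR' (hg.mono fun q hq => hq.1) hg'
      (hg.mono fun q hq => hq.2.2) hy⟩⟩

section UniformlyLipschitz

variable {ι : Type*} {l : Filter ι} {U : ι → Set E3} {V : Set E3} {x : E3} {L : ℝ≥0} {r h : ℝ}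

lemma IsGraphNear.of_frequently_mem (hV : IsOpen V)
    (hU : Tendsto (fun i => Metric.hausdorffEDist (U i)ᶜ Vᶜ) l (𝓝 0))
    (hg : ∀ i, ∀ y ∈ frontier (U i), IsGraphNear L r h (U i) y) (hx : x ∉ V)
    (hxU : ∃ᶠ q in l ×ˢ 𝓝 x, q.2 ∈ U q.1) : IsGraphNear L r h V x :=
  .of_frequently hV hU <|
    (frequently_mem_frontier_of_hausdorffEDist_compl hU hx hxU).mono fun q hq => hg q.1 q.2 hq

theorem IsGraphNear.of_mem_frontier [NeBot l] (hV : IsOpen V)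
    (hU : Tendsto (fun i => Metric.hausdorffEDist (U i)ᶜ Vᶜ) l (𝓝 0))
    (hg : ∀ i, ∀ y ∈ frontier (U i), IsGraphNear L r h (U i) y) (hx : x ∈ frontier V) :
    IsGraphNear L r h V x :=
  .of_frequently_mem hV hU hg (hV.frontier_eq ▸ hx).2
    (frequently_mem_of_mem_closure hV hU (frontier_subset_closure hx))

theorem eventually_notMem_of_notMem_closure (hr : 0 < r) (hh : 0 < h) (hV : IsOpen V)
    (hU : Tendsto (fun i => Metric.hausdorffEDist (U i)ᶜ Vᶜ) l (𝓝 0))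
    (hg : ∀ i, ∀ y ∈ frontier (U i), IsGraphNear L r h (U i) y) (hx : x ∉ closure V) :
    ∀ᶠ i in l, x ∉ U i := by
  suffices hprod : ∀ᶠ q in l ×ˢ 𝓝 x, q.2 ∉ U q.1 from
    hprod.curry.mono fun i hi => mem_of_mem_nhds hi
  by_contra hxU
  obtain ⟨R, g, -, g0, H⟩ := isGraphNear_iff.1 <| IsGraphNear.of_frequently_mem hV hU hg
    (fun hxV => hx (subset_closure hxV)) ((not_eventually.1 hxU).mono fun q hq => not_not.1 hq)
  exact hx (H.mem_closure hr hh g0)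

end UniformlyLipschitz

/-! ### Null boundaries and convergence of characteristic functions -/

lemma addHaar_eq_zero_of_forall_add_smul_notMem {E : Type*} [NormedAddCommGroup E] [NormedSpace ℝ E]
    [MeasurableSpace E] [BorelSpace E] [FiniteDimensional ℝ E] (μ : Measure E) [μ.IsAddHaarMeasure]
    {S : Set E} (hS : MeasurableSet S) (e : E) (he : ∀ y ∈ S, ∀ t : ℝ, t ≠ 0 → y + t • e ∉ S) :
    μ S = 0 := by
  let u : ℕ → ℝ := fun n => 1 / ((n : ℝ) + 1)
  have hu_inj : Function.Injective u := fun m n hmn => by simpa [u] using hmn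
  refine Measure.addHaar_eq_zero_of_disjoint_translates μ (fun n => u n • e) ?_ ?_ hS
  · exact Metric.isBounded_range_of_tendsto _
      (tendsto_one_div_add_atTop_nhds_zero_nat.smul_const (f := u) e)
  · intro m n hmn
    refine Set.disjoint_left.2 ?_
    rintro _ ⟨_, rfl, p, hp, rfl⟩ ⟨_, rfl, q, hq, hpq⟩
    refine he p hp (u m - u n) (sub_ne_zero.2 (hu_inj.ne hmn)) ?_
    have hq' : q = p + (u m - u n) • e := by
      rw [sub_smul, eq_sub_of_add_eq' hpq, add_sub_assoc', add_comm p]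
    rwa [← hq']

lemma volume_setOf_horiz_eq {g : EuclideanSpace ℝ (Fin 2) → ℝ} (hg : Continuous g) :
    volume {y : E3 | g (horiz y) = y 2} = 0 := by
  refine addHaar_eq_zero_of_forall_add_smul_notMem volume
    (isClosed_eq (by fun_prop) (by fun_prop)).measurableSet (EuclideanSpace.single 2 1) ?_
  intro y hy t ht hyt
  have hlift : g (horiz (lift y t)) = lift y t 2 := hyt
  rw [horiz_lift, lift_apply_two, hy] at hlift
  exact ht (by simpa using hlift.symm)

lemma IsEpigraphIn.volume_frontier_inter {r h : ℝ} {R : E3 ≃ₗᵢ[ℝ] E3}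
    {g : EuclideanSpace ℝ (Fin 2) → ℝ} (hg : Continuous g) {U : Set E3} {x : E3}
    (H : IsEpigraphIn r h R g U x) :
    volume (frontier U ∩ (fun y => x + R y) '' cylinder r h) = 0 := by
  let Φ : E3 ≃ₜ E3 := R.toHomeomorph.trans (Homeomorph.addLeft x)
  have hΦ : MeasurePreserving Φ volume volume :=
    (measurePreserving_add_left volume x).comp R.measurePreserving
  have hepi : Φ ⁻¹' U ∩ cylinder r h = {y | g (horiz y) < y 2} ∩ cylinder r h := by
    ext y
    exact and_congr_left fun hy => H y hy
  have hsub : Φ ⁻¹' (frontier U ∩ Φ '' cylinder r h) ⊆ {y | g (horiz y) = y 2} := by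
    rw [Set.preimage_inter, Set.preimage_image_eq _ Φ.injective, Φ.preimage_frontier,
      ← frontier_inter_open_inter (isOpen_cylinder r h), hepi,
      frontier_inter_open_inter (isOpen_cylinder r h)]
    exact Set.inter_subset_left.trans (frontier_lt_subset_eq (by fun_prop) (by fun_prop))
  change volume (frontier U ∩ Φ '' cylinder r h) = 0
  rw [← hΦ.measure_preimage_equiv (f := Φ.toMeasurableEquiv)]
  exact measure_mono_null hsub (volume_setOf_horiz_eq hg)

theorem volume_frontier_eq_zero {L : ℝ≥0} {r h : ℝ} (hr : 0 < r) (hh : 0 < h) {U : Set E3}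
    (hU : ∀ x ∈ frontier U, IsGraphNear L r h U x) : volume (frontier U) = 0 := by
  refine measure_null_of_locally_null _ fun x hx => ?_
  obtain ⟨R, g, hgL, -, H⟩ := isGraphNear_iff.1 (hU x hx)
  refine ⟨_, inter_mem self_mem_nhdsWithin (mem_nhdsWithin_of_mem_nhds ?_),
    H.volume_frontier_inter hgL.continuous⟩
  have hopen : IsOpen ((fun y => x + R y) '' cylinder r h) :=
    (R.toHomeomorph.trans (Homeomorph.addLeft x)).isOpenMap _ (isOpen_cylinder r h)
  exact hopen.mem_nhds ⟨0, zero_mem_cylinder hr hh, by simp⟩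

lemma HausdorffConv.tendsto_volume_symmDiff {L : ℝ≥0} {r h : ℝ} (hr : 0 < r) (hh : 0 < h)
    {B : Set E3} (hB : Bornology.IsBounded B) {ω : ℕ → Set E3} {ω' : Set E3}
    (hω : HausdorffConv ω ω') (hS : ∀ n, ω n ∈ Shapes B L r h) (hS' : ω' ∈ Shapes B L r h) :
    Tendsto (fun n => volume (symmDiff (ω n) ω')) atTop (𝓝 0) := by
  rw [← measure_empty (μ := (volume : Measure E3))]
  refine tendsto_measure_of_ae_tendsto_indicator (B := closure B) atTop .empty
    (fun n => (hS n).2.1.measurableSet.symmDiff hS'.2.1.measurableSet)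
    isClosed_closure.measurableSet hB.closure.measure_lt_top.ne
    (Eventually.of_forall fun n => (symmDiff_le_sup.trans (sup_le (hS n).1 hS'.1)).trans
      subset_closure) ?_
  filter_upwards [measure_eq_zero_iff_ae_notMem.1 (volume_frontier_eq_zero hr hh hS'.2.2)]
    with x hx
  suffices hmem : ∀ᶠ n in atTop, (x ∈ ω n ↔ x ∈ ω') from
    hmem.mono fun n hn => by simp [Set.mem_symmDiff, hn]
  by_cases hxω : x ∈ ω'
  · filter_upwards [(eventually_mem_of_hausdorffEDist_compl hS'.2.1 hω hxω).curry] with n hn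
    exact iff_of_true (mem_of_mem_nhds hn) hxω
  · have hxcl : x ∉ closure ω' := fun hc => hx (hS'.2.1.frontier_eq ▸ ⟨hc, hxω⟩)
    filter_upwards [eventually_notMem_of_notMem_closure hr hh hS'.2.1 hω (fun n => (hS n).2.2) hxcl]
      with n hn
    exact iff_of_false hn hxω

lemma charConv_of_tendsto_volume_symmDiff {ω : ℕ → Set E3} {ω' : Set E3}
    (hω : ∀ n, MeasurableSet (ω n)) (hω' : MeasurableSet ω')
    (hvol : Tendsto (fun n => volume (symmDiff (ω n) ω')) atTop (𝓝 0)) : CharConv ω ω' := by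
  intro p hp hp'
  have hp0 : p ≠ 0 := (zero_lt_one.trans_le hp).ne'
  have hpow : 0 < 1 / p.toReal := one_div_pos.2 (ENNReal.toReal_pos hp0 hp')
  have hrpow := ((ENNReal.continuous_rpow_const (y := 1 / p.toReal)).tendsto 0).comp hvol
  rw [ENNReal.zero_rpow_of_pos hpow] at hrpow
  simp only [eLpNorm_indicator_sub_indicator,
    eLpNorm_indicator_const ((hω _).symmDiff hω') hp0 hp', enorm_one, one_mul]
  exact hrpow

/-! ### Compactness -/

theorem exists_subseq_tendsto_hausdorffEDist_compl {X : Type*} [MetricSpace X] [ProperSpace X]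
    {B : Set X} (hB : Bornology.IsBounded B) {U : ℕ → Set X} (hU : ∀ n, IsOpen (U n))
    (hUB : ∀ n, U n ⊆ B) : ∃ s : ℕ → ℕ, StrictMono s ∧ ∃ V : Set X, IsOpen V ∧
      Tendsto (fun k => Metric.hausdorffEDist (U (s k))ᶜ Vᶜ) atTop (𝓝 0) := by
  let K : Set X := closure B
  have : CompactSpace K := isCompact_iff_compactSpace.1 hB.isCompact_closure
  let C : ℕ → TopologicalSpace.Closeds K := fun n =>
    ⟨(↑) ⁻¹' (U n)ᶜ, (hU n).isClosed_compl.preimage continuous_subtype_val⟩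
  have hC : ∀ n, (U n)ᶜ = (↑) '' (C n : Set K) ∪ Kᶜ := fun n => by
    have hK : Kᶜ ⊆ (U n)ᶜ := Set.compl_subset_compl.2 ((hUB n).trans subset_closure)
    rw [TopologicalSpace.Closeds.coe_mk, Subtype.image_preimage_coe, Set.inter_union_distrib_right,
      Set.union_compl_self, Set.univ_inter, Set.union_eq_left.2 hK]
  obtain ⟨F, s, hs, hF⟩ := CompactSpace.tendsto_subseq C
  refine ⟨s, hs, (closure (Subtype.val '' (F : Set K) ∪ Kᶜ))ᶜ, isClosed_closure.isOpen_compl, ?_⟩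
  refine tendsto_of_tendsto_of_tendsto_of_le_of_le tendsto_const_nhds
    (tendsto_iff_edist_tendsto_0.1 hF) (fun _ => zero_le) fun k => ?_
  calc Metric.hausdorffEDist (U (s k))ᶜ (closure (Subtype.val '' (F : Set K) ∪ Kᶜ))ᶜᶜ
      = Metric.hausdorffEDist (Subtype.val '' (C (s k) : Set K) ∪ Kᶜ)
          (Subtype.val '' (F : Set K) ∪ Kᶜ) := by
        rw [compl_compl, Metric.hausdorffEDist_closure_right, hC]
    _ ≤ max (Metric.hausdorffEDist (Subtype.val '' (C (s k) : Set K))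
          (Subtype.val '' (F : Set K)))
          (Metric.hausdorffEDist Kᶜ Kᶜ) := Metric.hausdorffEDist_union_le
    _ = edist (C (s k)) F := by
        rw [Metric.hausdorffEDist_self, Metric.hausdorffEDist_image isometry_subtype_coe,
          TopologicalSpace.Closeds.edist_eq]
        simp

theorem exists_subseq_hausdorffConv {L : ℝ≥0} {r h : ℝ} {B : Set E3} (hB : Bornology.IsBounded B)
    {ω : ℕ → Set E3} (hS : ∀ n, ω n ∈ Shapes B L r h) :
    ∃ s : ℕ → ℕ, StrictMono s ∧ ∃ ω' ∈ Shapes B L r h, HausdorffConv (fun k => ω (s k)) ω' := by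
  obtain ⟨s, hs, ω', hω', hconv⟩ :=
    exists_subseq_tendsto_hausdorffEDist_compl hB (fun n => (hS n).2.1) (fun n => (hS n).1)
  exact ⟨s, hs, ω', ⟨subset_of_hausdorffEDist_compl hω' hconv fun k => (hS (s k)).1, hω',
    fun x hx => .of_mem_frontier hω' hconv (fun k => (hS (s k)).2.2) hx⟩, hconv⟩

/-! ### The penalty law -/

section RegMax

variable {γ : ℝ} {x y : ℝ}

-- `max {1, x}` is the maximum of `(1 - s) + s x` over `s ∈ [0, 1]`, and the smoothing amounts to
-- adding the strictly concave term `s (1 - s) / (2 γ)`; all estimates of `regMax` follow from this.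
lemma isGreatest_regMax (hγ : 0 < γ) (x : ℝ) :
    IsGreatest ((fun s => 1 + s * (x - 1) + s * (1 - s) / (2 * γ)) '' Set.Icc 0 1)
      (regMax γ x) := by
  obtain ⟨a, ha, rfl⟩ : ∃ a : ℝ, 0 < a ∧ γ = 1 / (2 * a) :=
    ⟨1 / (2 * γ), by positivity, by field_simp⟩
  have ha' : 1 / (2 * (1 / (2 * a))) = a := by field_simp
  have hval : ∀ s : ℝ, s * (1 - s) / (2 * (1 / (2 * a))) = s * (1 - s) * a := fun s => by field_simp
  simp only [regMax, ha', hval]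
  split_ifs with h₁ h₂
  · refine ⟨⟨1, by simp, by ring⟩, ?_⟩
    rintro _ ⟨s, ⟨-, hs₁⟩, rfl⟩
    nlinarith [mul_le_mul_of_nonneg_left h₁ (sub_nonneg.2 hs₁),
      mul_nonneg ha.le (sq_nonneg (1 - s))]
  · obtain ⟨h₂, h₃⟩ := abs_le.1 h₂
    refine ⟨⟨(x - 1 + a) / (2 * a), ⟨by apply div_nonneg <;> linarith,
      (div_le_one (by positivity)).2 (by linarith)⟩, by field_simp; ring⟩, ?_⟩
    rintro _ ⟨s, -, rfl⟩
    have hsq : 1 + 1 / (2 * a) / 2 * (x - 1 + a) ^ 2 - (1 + s * (x - 1) + s * (1 - s) * a) =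
        (x - 1 + a - 2 * a * s) ^ 2 / (4 * a) := by field_simp; ring
    exact sub_nonneg.1 (hsq ▸ by positivity)
  · have h₃ : x - 1 ≤ -a := by
      by_contra! h
      exact h₂ (abs_le.2 ⟨h.le, (not_le.1 h₁).le⟩)
    refine ⟨⟨0, by simp, by ring⟩, ?_⟩
    rintro _ ⟨s, ⟨hs₀, -⟩, rfl⟩
    nlinarith [mul_le_mul_of_nonneg_left h₃ hs₀, mul_nonneg ha.le (sq_nonneg s)]

lemma one_le_regMax (hγ : 0 < γ) (x : ℝ) : 1 ≤ regMax γ x :=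
  (isGreatest_regMax hγ x).2 ⟨0, by simp, by ring⟩

lemma regMax_pos (hγ : 0 < γ) (x : ℝ) : 0 < regMax γ x :=
  zero_lt_one.trans_le (one_le_regMax hγ x)

lemma le_regMax (hγ : 0 < γ) (x : ℝ) : x ≤ regMax γ x :=
  (isGreatest_regMax hγ x).2 ⟨1, by simp, by ring⟩

lemma regMax_le_add (hγ : 0 < γ) (hx : 0 ≤ x) : regMax γ x ≤ x + (1 + 1 / (2 * γ)) := by
  obtain ⟨s, ⟨hs₀, hs₁⟩, hs⟩ := (isGreatest_regMax hγ x).1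
  have hle : s * (1 - s) / (2 * γ) ≤ 1 / (2 * γ) := by gcongr; nlinarith
  simp only at hs
  nlinarith

lemma regMax_sub_le (hγ : 0 < γ) (x y : ℝ) : regMax γ x - regMax γ y ≤ |x - y| := by
  obtain ⟨s, ⟨hs₀, hs₁⟩, hs⟩ := (isGreatest_regMax hγ x).1
  have hy : 1 + s * (y - 1) + s * (1 - s) / (2 * γ) ≤ regMax γ y :=
    (isGreatest_regMax hγ y).2 ⟨s, ⟨hs₀, hs₁⟩, rfl⟩
  have hxy : s * (x - y) ≤ |x - y| :=
    (mul_le_mul_of_nonneg_left (le_abs_self _) hs₀).trans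
      (mul_le_of_le_one_left (abs_nonneg _) hs₁)
  simp only at hs
  linarith

lemma abs_regMax_sub_le (hγ : 0 < γ) (x y : ℝ) : |regMax γ x - regMax γ y| ≤ |x - y| :=
  abs_sub_le_iff.2 ⟨regMax_sub_le hγ x y, abs_sub_comm x y ▸ regMax_sub_le hγ y x⟩

lemma div_regMax_le_div_regMax (hγ : 0 < γ) (hx : 0 ≤ x) (hxy : x ≤ y) :
    x / regMax γ x ≤ y / regMax γ y := by
  rw [div_le_div_iff₀ (regMax_pos hγ x) (regMax_pos hγ y)]
  obtain ⟨s, ⟨hs₀, hs₁⟩, hs⟩ := (isGreatest_regMax hγ y).1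
  have hx' : 1 + s * (x - 1) + s * (1 - s) / (2 * γ) ≤ regMax γ x :=
    (isGreatest_regMax hγ x).2 ⟨s, ⟨hs₀, hs₁⟩, rfl⟩
  have hc : 0 ≤ (1 - s) + s * (1 - s) / (2 * γ) := by
    have := sub_nonneg.2 hs₁
    positivity
  calc x * regMax γ y = x * ((1 - s) + s * (1 - s) / (2 * γ)) + s * x * y := by rw [← hs]; ring
    _ ≤ y * ((1 - s) + s * (1 - s) / (2 * γ)) + s * x * y := by gcongr
    _ = y * (1 + s * (x - 1) + s * (1 - s) / (2 * γ)) := by ring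
    _ ≤ y * regMax γ x := by gcongr; exact hx.trans hxy

end RegMax

/-- The constitutive law `x ↦ j γ x / max_γ {1, γ |x|}` of the penalized problem. -/
def penLaw {F : Type*} [NormedAddCommGroup F] [NormedSpace ℝ F] (j γ : ℝ) (x : F) : F :=
  (j * γ / regMax γ (γ * ‖x‖)) • x

section PenLaw

variable {F : Type*} {j γ : ℝ}

section Normed

variable [NormedAddCommGroup F] [NormedSpace ℝ F]

lemma norm_penLaw_le (hj : 0 ≤ j) (hγ : 0 < γ) (x : F) : ‖penLaw j γ x‖ ≤ j := by
  have hpos := regMax_pos hγ (γ * ‖x‖)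
  calc ‖penLaw j γ x‖ = j * ((γ * ‖x‖) / regMax γ (γ * ‖x‖)) := by
        rw [penLaw, norm_smul, Real.norm_of_nonneg (by positivity)]
        ring
    _ ≤ j := mul_le_of_le_one_right hj ((div_le_one hpos).2 (le_regMax hγ _))

lemma norm_penLaw_sub_le (hj : 0 ≤ j) (hγ : 0 < γ) (x y : F) :
    ‖penLaw j γ x - penLaw j γ y‖ ≤ 2 * (j * γ) * ‖x - y‖ := by
  set m := regMax γ (γ * ‖x‖)
  set n := regMax γ (γ * ‖y‖)
  have hm : 1 ≤ m := one_le_regMax hγ _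
  have hn : 0 < n := regMax_pos hγ _
  have hyn : γ * ‖y‖ ≤ n := le_regMax hγ _
  have hnm : |n - m| ≤ γ * ‖x - y‖ := by
    refine (abs_regMax_sub_le hγ _ _).trans ?_
    rw [← mul_sub, abs_mul, abs_of_pos hγ]
    gcongr
    exact norm_sub_rev x y ▸ abs_norm_sub_norm_le y x
  have hdecomp : penLaw j γ x - penLaw j γ y =
      (j * γ / m) • (x - y) + (j * γ * (n - m) / (m * n)) • y := by
    have hcoef : j * γ * (n - m) / (m * n) = j * γ / m - j * γ / n := by field_simp
    rw [penLaw, penLaw, hcoef, smul_sub, sub_smul]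
    abel
  have h₁ : j * γ / m * ‖x - y‖ ≤ j * γ * ‖x - y‖ := by
    gcongr
    exact div_le_self (by positivity) hm
  have h₂ : |j * γ * (n - m) / (m * n)| * ‖y‖ ≤ j * γ * ‖x - y‖ := by
    rw [abs_div, abs_mul, abs_of_nonneg (show 0 ≤ j * γ by positivity),
      abs_of_pos (show 0 < m * n by positivity), div_mul_eq_mul_div, div_le_iff₀ (by positivity)]
    calc j * γ * |n - m| * ‖y‖ ≤ j * γ * (γ * ‖x - y‖) * ‖y‖ := by gcongr
      _ = j * γ * ‖x - y‖ * (1 * (γ * ‖y‖)) := by ring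
      _ ≤ j * γ * ‖x - y‖ * (m * n) := by gcongr
  calc ‖penLaw j γ x - penLaw j γ y‖
      ≤ j * γ / m * ‖x - y‖ + |j * γ * (n - m) / (m * n)| * ‖y‖ := by
        rw [hdecomp]
        refine (norm_add_le _ _).trans_eq ?_
        rw [norm_smul, norm_smul, Real.norm_of_nonneg (by positivity), Real.norm_eq_abs]
    _ ≤ 2 * (j * γ) * ‖x - y‖ := by linarith

lemma lipschitzWith_penLaw (hj : 0 ≤ j) (hγ : 0 < γ) :
    LipschitzWith (2 * (j * γ)).toNNReal (penLaw j γ : F → F) :=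
  .of_dist_le' fun x y => by simpa only [dist_eq_norm] using norm_penLaw_sub_le hj hγ x y

end Normed

variable [NormedAddCommGroup F] [InnerProductSpace ℝ F]

lemma inner_smul_sub_smul_nonneg {a b : ℝ} {x y : F} (ha : 0 ≤ a) (hb : 0 ≤ b) (hxy : ‖x‖ ≤ ‖y‖)
    (hab : a * ‖x‖ ≤ b * ‖y‖) : 0 ≤ inner ℝ (a • x - b • y) (x - y) := by
  have hexpand : inner ℝ (a • x - b • y) (x - y) =
      a * ‖x‖ ^ 2 + b * ‖y‖ ^ 2 - (a + b) * inner ℝ x y := by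
    simp only [inner_sub_left, inner_sub_right, real_inner_smul_left, real_inner_self_eq_norm_sq,
      real_inner_comm x y]
    ring
  have hcs := mul_le_mul_of_nonneg_left (real_inner_le_norm x y) (add_nonneg ha hb)
  nlinarith [mul_nonneg (sub_nonneg.2 hab) (sub_nonneg.2 hxy)]

lemma inner_penLaw_sub_nonneg (hj : 0 ≤ j) (hγ : 0 < γ) (x y : F) :
    0 ≤ inner ℝ (penLaw j γ x - penLaw j γ y) (x - y) := by
  wlog hxy : ‖x‖ ≤ ‖y‖ generalizing x y
  · rw [← neg_sub (penLaw j γ y), ← neg_sub y x, inner_neg_neg]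
    exact this y x (le_of_not_ge hxy)
  have hcoef : ∀ z : F, 0 ≤ j * γ / regMax γ (γ * ‖z‖) := fun z =>
    div_nonneg (by positivity) (regMax_pos hγ _).le
  refine inner_smul_sub_smul_nonneg (hcoef x) (hcoef y) hxy ?_
  calc j * γ / regMax γ (γ * ‖x‖) * ‖x‖ = j * (γ * ‖x‖ / regMax γ (γ * ‖x‖)) := by ring
    _ ≤ j * (γ * ‖y‖ / regMax γ (γ * ‖y‖)) := by
        gcongr ?_ * ?_
        exact div_regMax_le_div_regMax hγ (by positivity) (by gcongr)
    _ = j * γ / regMax γ (γ * ‖y‖) * ‖y‖ := by ring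

lemma le_inner_penLaw (hj : 0 ≤ j) (hγ : 0 < γ) (x : F) :
    j * ‖x‖ - j / γ * (1 + 1 / (2 * γ)) ≤ inner ℝ (penLaw j γ x) x := by
  set m := regMax γ (γ * ‖x‖)
  have hm : 0 < m := regMax_pos hγ _
  have hxm : γ * ‖x‖ / m ≤ 1 := (div_le_one hm).2 (le_regMax hγ _)
  have hdefect : j * ‖x‖ - inner ℝ (penLaw j γ x) x =
      j / γ * ((m - γ * ‖x‖) * (γ * ‖x‖ / m)) := by
    rw [penLaw, real_inner_smul_left, real_inner_self_eq_norm_sq,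
      show regMax γ (γ * ‖x‖) = m from rfl]
    field_simp
  have hle : (m - γ * ‖x‖) * (γ * ‖x‖ / m) ≤ 1 + 1 / (2 * γ) :=
    (mul_le_of_le_one_right (sub_nonneg.2 (le_regMax hγ _)) hxm).trans
      (by linarith [regMax_le_add hγ (show 0 ≤ γ * ‖x‖ by positivity)])
  have := mul_le_mul_of_nonneg_left hle (div_nonneg hj hγ.le)
  linarith

end PenLaw

/-! ### Multiplication and restriction in `L²` -/

section Lp

variable {α F : Type*} [MeasurableSpace α] {μ : Measure α} [NormedAddCommGroup F]

section Normed

variable [NormedSpace ℝ F] {p q s : ℝ≥0∞} {S : Set α}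

/-- Pointwise application of an essentially bounded field of operators, acting on `L²`. -/
def mulOp {A : α → F →L[ℝ] F} (hA : MemLp A ∞ μ) : Lp F 2 μ →L[ℝ] Lp F 2 μ :=
  (ContinuousLinearMap.id ℝ (F →L[ℝ] F)).holderL μ ∞ 2 2 (hA.toLp A)

lemma coeFn_mulOp {A : α → F →L[ℝ] F} (hA : MemLp A ∞ μ) (f : Lp F 2 μ) :
    mulOp hA f =ᵐ[μ] fun x => A x (f x) := by
  filter_upwards [ContinuousLinearMap.coeFn_holder (r := 2) (ContinuousLinearMap.id ℝ (F →L[ℝ] F))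
    (hA.toLp A) f, hA.coeFn_toLp] with x hx hAx
  rw [← hAx]
  exact hx

/-- Multiplication by the characteristic function of `S`, as an operator `L^q → L^s`; the gain of
integrability comes from Hölder's inequality with `1_S ∈ L^p`. -/
def indicatorMul (p q s : ℝ≥0∞) [Fact (1 ≤ p)] [Fact (1 ≤ q)] [Fact (1 ≤ s)]
    [ENNReal.HolderTriple p q s] (hS : MeasurableSet S) (hμS : μ S ≠ ∞) :
    Lp F q μ →L[ℝ] Lp F s μ :=
  (ContinuousLinearMap.lsmul ℝ ℝ).holderL μ p q s (indicatorConstLp p hS hμS (1 : ℝ))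

section IndicatorMul

variable [Fact (1 ≤ p)] [Fact (1 ≤ q)] [Fact (1 ≤ s)] [ENNReal.HolderTriple p q s]

lemma coeFn_indicatorMul (hS : MeasurableSet S) (hμS : μ S ≠ ∞) (f : Lp F q μ) :
    indicatorMul p q s hS hμS f =ᵐ[μ] S.indicator f := by
  filter_upwards [ContinuousLinearMap.coeFn_holder (r := s)
    (ContinuousLinearMap.lsmul ℝ ℝ : ℝ →L[ℝ] F →L[ℝ] F) (indicatorConstLp p hS hμS (1 : ℝ)) f,
    indicatorConstLp_coeFn (p := p) (hs := hS) (hμs := hμS) (c := (1 : ℝ))] with x hx hSx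
  refine Eq.trans hx ?_
  rw [hSx]
  by_cases h : x ∈ S <;> simp [h]

lemma norm_indicatorMul_le (hS : MeasurableSet S) (hμS : μ S ≠ ∞) (f : Lp F q μ) :
    ‖indicatorMul p q s hS hμS f‖ ≤ ‖indicatorConstLp p hS hμS (1 : ℝ)‖ * ‖f‖ := by
  refine (ContinuousLinearMap.norm_holder_apply_apply_le _ _ f).trans ?_
  gcongr
  exact mul_le_of_le_one_left (norm_nonneg _) (ContinuousLinearMap.opNorm_lsmul_le)

end IndicatorMul

lemma norm_indicatorMul_one (hS : MeasurableSet S) (hμS : μ S ≠ ∞) (f : Lp F 2 μ) :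
    ‖indicatorMul 2 2 1 hS hμS f‖ = ∫ x in S, ‖f x‖ ∂μ := by
  rw [L1.norm_eq_integral_norm, ← integral_indicator hS]
  refine integral_congr_ae ?_
  filter_upwards [coeFn_indicatorMul (p := 2) (s := 1) hS hμS f] with x hx
  rw [hx, norm_indicator_eq_indicator_norm]

lemma setIntegral_norm_le (hS : MeasurableSet S) (hμS : μ S ≠ ∞) (f : Lp F 2 μ) :
    ∫ x in S, ‖f x‖ ∂μ ≤ √(μ.real S) * ‖f‖ := by
  rw [← norm_indicatorMul_one hS hμS]
  refine (norm_indicatorMul_le hS hμS f).trans_eq ?_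
  rw [norm_indicatorConstLp two_ne_zero ENNReal.ofNat_ne_top, Real.sqrt_eq_rpow]
  simp

end Normed

lemma integrableOn_norm {S : Set α} (hμS : μ S ≠ ∞) (f : Lp F 2 μ) :
    IntegrableOn (fun x => ‖f x‖) S μ := by
  have : IsFiniteMeasure (μ.restrict S) := isFiniteMeasure_restrict.2 hμS
  exact ((Lp.memLp f).restrict S).integrable one_le_two |>.norm

lemma setIntegral_sub_setIntegral_le {S T : Set α} {f : α → ℝ} (hS : MeasurableSet S)
    (hT : MeasurableSet T) (hfS : IntegrableOn f S μ) (hfT : IntegrableOn f T μ) :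
    (∫ x in S, f x ∂μ) - ∫ x in T, f x ∂μ ≤ ∫ x in symmDiff S T, |f x| ∂μ := by
  have hfS' : IntegrableOn f (S \ T) μ := hfS.mono_set Set.sdiff_subset
  have hfT' : IntegrableOn f (T \ S) μ := hfT.mono_set Set.sdiff_subset
  calc (∫ x in S, f x ∂μ) - ∫ x in T, f x ∂μ
      = (∫ x in S \ T, f x ∂μ) + ∫ x in T \ S, -f x ∂μ := by
        rw [← integral_inter_add_sdiff hT hfS, ← integral_inter_add_sdiff hS hfT, Set.inter_comm T,
          integral_neg]
        ring
    _ ≤ (∫ x in S \ T, |f x| ∂μ) + ∫ x in T \ S, |f x| ∂μ := by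
        exact add_le_add (integral_mono hfS' hfS'.abs fun x => le_abs_self _)
          (integral_mono hfT'.neg hfT'.abs fun x => neg_le_abs _)
    _ = ∫ x in symmDiff S T, |f x| ∂μ :=
        (setIntegral_union disjoint_sdiff_sdiff (hT.diff hS) hfS'.abs hfT'.abs).symm

section Inner

variable [InnerProductSpace ℝ F]

lemma inner_mulOp {A : α → F →L[ℝ] F} (hA : MemLp A ∞ μ) (f g : Lp F 2 μ) :
    inner ℝ (mulOp hA f) g = ∫ x, inner ℝ (A x (f x)) (g x) ∂μ := by
  rw [L2.inner_def]
  refine integral_congr_ae ?_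
  filter_upwards [coeFn_mulOp hA f] with x hx
  rw [hx]

lemma mul_norm_sq_le_inner_mulOp {A : α → F →L[ℝ] F} (hA : MemLp A ∞ μ) {c : ℝ}
    (hc : ∀ᵐ x ∂μ, ∀ ξ : F, c * ‖ξ‖ ^ 2 ≤ inner ℝ ξ (A x ξ)) (f : Lp F 2 μ) :
    c * ‖f‖ ^ 2 ≤ inner ℝ (mulOp hA f) f := by
  rw [← real_inner_self_eq_norm_sq, ← real_inner_smul_left, L2.inner_def, L2.inner_def]
  refine integral_mono_ae (L2.integrable_inner _ _) (L2.integrable_inner _ _) ?_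
  filter_upwards [hc, coeFn_mulOp hA f, Lp.coeFn_smul c f] with x hcx hAx hsx
  rw [hAx, hsx, Pi.smul_apply, real_inner_smul_left, real_inner_self_eq_norm_sq,
    real_inner_comm]
  exact hcx (f x)

lemma ae_norm_le_of_inner_le {m : α → ℝ} (hm : Measurable m) (hm₀ : ∀ x, 0 ≤ m x) {f : Lp F 2 μ}
    (h : ∀ g : Lp F 2 μ, inner ℝ f g ≤ ∫ x, m x * ‖g x‖ ∂μ) : ∀ᵐ x ∂μ, ‖f x‖ ≤ m x := by
  have hf : StronglyMeasurable f := Lp.stronglyMeasurable f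
  set S : Set α := {x | m x < ‖f x‖}
  have hS : MeasurableSet S := measurableSet_lt hm hf.norm.measurable
  have hfS : MemLp (S.indicator f) 2 μ := (Lp.memLp f).indicator hS
  have hsq : IntegrableOn (fun x => ‖f x‖ ^ 2) S μ :=
    ((memLp_two_iff_integrable_sq_norm hf.aestronglyMeasurable).1 (Lp.memLp f)).integrableOn
  have hmul : IntegrableOn (fun x => m x * ‖f x‖) S μ := by
    refine hsq.mono' (hm.aestronglyMeasurable.mul hf.norm.aestronglyMeasurable)
      ((ae_restrict_mem hS).mono fun x (hx : m x < ‖f x‖) => ?_)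
    rw [Real.norm_of_nonneg (mul_nonneg (hm₀ x) (norm_nonneg _)), sq]
    gcongr
  have htest : ∫ x in S, ‖f x‖ ^ 2 ∂μ ≤ ∫ x in S, m x * ‖f x‖ ∂μ := by
    convert h (hfS.toLp _) using 1
    · rw [L2.inner_def, ← integral_indicator hS]
      refine integral_congr_ae (hfS.coeFn_toLp.mono fun x hx => ?_)
      simp only [hx]
      by_cases hxS : x ∈ S <;> simp [hxS]
    · rw [← integral_indicator hS]
      refine integral_congr_ae (hfS.coeFn_toLp.mono fun x hx => ?_)
      simp only [hx]
      by_cases hxS : x ∈ S <;> simp [hxS]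
  have hpos : ∀ x ∈ S, 0 < ‖f x‖ ^ 2 - m x * ‖f x‖ := fun x (hx : m x < ‖f x‖) => by
    nlinarith [hm₀ x]
  by_contra hne
  have hμS : 0 < μ S := by
    refine pos_iff_ne_zero.2 fun h0 => hne ?_
    filter_upwards [measure_eq_zero_iff_ae_notMem.1 h0] with x hx using not_lt.1 hx
  have hint : 0 < ∫ x in S, (‖f x‖ ^ 2 - m x * ‖f x‖) ∂μ := by
    rw [setIntegral_pos_iff_support_of_nonneg_ae
      ((ae_restrict_mem hS).mono fun x hx => (hpos x hx).le) (hsq.sub hmul)]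
    exact hμS.trans_le (measure_mono fun x hx => ⟨(hpos x hx).ne', hx⟩)
  rw [integral_sub hsq hmul] at hint
  linarith

end Inner

end Lp

/-! ### Strongly monotone operators -/

section Monotone

variable {H : Type*} [NormedAddCommGroup H] [InnerProductSpace ℝ H] {T : H → H} {K : ℝ≥0} {c : ℝ}

lemma norm_sub_smul_sq_le (hT : LipschitzWith K T)
    (hc : ∀ x y, c * ‖x - y‖ ^ 2 ≤ inner ℝ (T x - T y) (x - y)) {t : ℝ} (ht : 0 ≤ t)
    (htK : t * (K ^ 2 + 1) = c) (x y : H) :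
    ‖(x - y) - t • (T x - T y)‖ ^ 2 ≤ (1 - t * c) * ‖x - y‖ ^ 2 := by
  have hlip : ‖T x - T y‖ ^ 2 ≤ (K * ‖x - y‖) ^ 2 := by
    gcongr
    simpa only [dist_eq_norm] using hT.dist_le_mul x y
  rw [norm_sub_sq_real, real_inner_smul_right, real_inner_comm, norm_smul, mul_pow,
    Real.norm_of_nonneg ht]
  have h₁ := mul_le_mul_of_nonneg_left (hc x y) ht
  have h₂ := mul_le_mul_of_nonneg_left hlip (sq_nonneg t)
  subst htK
  nlinarith [mul_nonneg (sq_nonneg t) (sq_nonneg ‖x - y‖)]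

theorem surjective_of_stronglyMonotone [CompleteSpace H] (hT : LipschitzWith K T) (hc₀ : 0 < c)
    (hc : ∀ x y, c * ‖x - y‖ ^ 2 ≤ inner ℝ (T x - T y) (x - y)) : Function.Surjective T := by
  intro y
  set t : ℝ := c / (K ^ 2 + 1)
  have ht : 0 < t := by positivity
  have htK : t * (K ^ 2 + 1) = c := div_mul_cancel₀ _ (by positivity)
  let Φ : H → H := fun x => x - t • (T x - y)
  have hΦ : LipschitzWith (√(1 - t * c)).toNNReal Φ := .of_dist_le' fun x₁ x₂ => by
    have hsub : Φ x₁ - Φ x₂ = (x₁ - x₂) - t • (T x₁ - T x₂) := by simp only [Φ]; module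
    rw [dist_eq_norm, dist_eq_norm, hsub, ← Real.sqrt_sq (norm_nonneg (x₁ - x₂)),
      ← Real.sqrt_mul' _ (sq_nonneg _)]
    exact Real.le_sqrt_of_sq_le (norm_sub_smul_sq_le hT hc ht.le htK x₁ x₂)
  have hcontr : ContractingWith (√(1 - t * c)).toNNReal Φ := by
    refine ⟨Real.toNNReal_lt_one.2 ?_, hΦ⟩
    rw [Real.sqrt_lt' one_pos]
    nlinarith [mul_pos ht hc₀]
  have hfix : Φ _ = _ := hcontr.fixedPoint_isFixedPt
  exact ⟨_, sub_eq_zero.1 ((smul_eq_zero.1 (sub_eq_self.1 hfix)).resolve_left ht.ne')⟩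

end Monotone

/-! ### The space `H₀(curl)` -/

section H0curl

variable {Ω : Set E3}

/-- `fld` as a continuous linear map. -/
def fldL (Ω : Set E3) : H0curl Ω →L[ℝ] L2 Ω :=
  (WithLp.fstL 2 ℝ (L2 Ω) (L2 Ω)).comp (H0curl Ω).subtypeL

/-- `rot` as a continuous linear map. -/
def rotL (Ω : Set E3) : H0curl Ω →L[ℝ] L2 Ω :=
  (WithLp.sndL 2 ℝ (L2 Ω) (L2 Ω)).comp (H0curl Ω).subtypeL

lemma fldL_apply (v : H0curl Ω) : fldL Ω v = fld v := rfl

instance : CompleteSpace (H0curl Ω) := (testPairs Ω).isClosed_topologicalClosure.completeSpace_coe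

lemma norm_sq_eq (v : H0curl Ω) : ‖v‖ ^ 2 = ‖fld v‖ ^ 2 + ‖rot v‖ ^ 2 :=
  WithLp.prod_norm_sq_eq_of_L2 (v : Pair Ω)

lemma norm_fld_le (v : H0curl Ω) : ‖fld v‖ ≤ ‖v‖ :=
  pow_le_pow_iff_left₀ (norm_nonneg _) (norm_nonneg _) two_ne_zero |>.1
    (norm_sq_eq v ▸ le_add_of_nonneg_right (sq_nonneg _))

lemma toDual_apply (lam : L2 Ω) (v : H0curl Ω) : toDual lam v = inner ℝ lam (fld v) := rfl

lemma toDual_sub (lam lam' : L2 Ω) : toDual (lam - lam') = toDual lam - toDual lam' := by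
  ext v
  simp only [sub_apply, toDual_apply, inner_sub_left]

lemma norm_toDual (lam : L2 Ω) : ‖toDual lam‖ = ‖(fldL Ω).adjoint lam‖ := by
  have hlam : toDual lam = innerSL ℝ ((fldL Ω).adjoint lam) := by
    ext v
    exact (ContinuousLinearMap.adjoint_inner_left (fldL Ω) v lam).symm
  rw [hlam, innerSL_apply_norm]

lemma exists_fld_ae_eq {φ : E3 → E3} (hφ : IsTest Ω φ) :
    ∃ v : H0curl Ω, fld v =ᵐ[volume.restrict Ω] φ := by
  have hφ₂ : MemLp φ 2 (volume.restrict Ω) :=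
    hφ.differentiable.continuous.memLp_of_hasCompactSupport hφ.compact
  have hcurl : MemLp (curl φ) 2 (volume.restrict Ω) :=
    hφ.continuous_curl.memLp_of_hasCompactSupport hφ.hasCompactSupport_curl
  exact ⟨⟨WithLp.toLp 2 (hφ₂.toLp _, hcurl.toLp _),
    Submodule.le_topologicalClosure _ ⟨_, hφ, hφ₂.coeFn_toLp, hcurl.coeFn_toLp⟩⟩, hφ₂.coeFn_toLp⟩

lemma isTest_smul_const {g : E3 → ℝ} (hg : ContDiff ℝ (⊤ : ℕ∞) g) (hgc : HasCompactSupport g)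
    (hgs : tsupport g ⊆ Ω) (ξ : E3) : IsTest Ω fun x => g x • ξ :=
  ⟨hg.smul contDiff_const, hgc.smul_right,
    (closure_mono (Function.support_smul_subset_left g fun _ => ξ)).trans hgs⟩

lemma toDual_injective (hΩ : IsOpen Ω) :
    Function.Injective (toDual : L2 Ω → H0curl Ω →L[ℝ] ℝ) := by
  intro p q hpq
  have hloc : LocallyIntegrableOn (p - q : L2 Ω) Ω :=
    locallyIntegrableOn_of_locallyIntegrable_restrict
      ((Lp.memLp (p - q)).locallyIntegrable one_le_two)
  suffices h : ∀ᵐ x, x ∈ Ω → (p - q : L2 Ω) x = 0 by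
    refine sub_eq_zero.1 (Lp.eq_zero_iff_ae_eq_zero.2 ?_)
    exact (ae_restrict_iff' hΩ.measurableSet).2 h
  refine hΩ.ae_eq_zero_of_integral_contDiff_smul_eq_zero hloc fun g hg hgc hgs => ?_
  have hint : IntegrableOn (fun x => g x • (p - q : L2 Ω) x) Ω :=
    memLp_one_iff_integrable.1
      ((Lp.memLp (p - q)).smul (hg.continuous.memLp_of_hasCompactSupport hgc (p := 2)))
  rw [← setIntegral_eq_integral_of_forall_compl_eq_zero (s := Ω) fun x hx => by
    rw [image_eq_zero_of_notMem_tsupport fun h => hx (hgs h), zero_smul]]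
  refine ext_inner_right ℝ fun ξ => ?_
  obtain ⟨v, hv⟩ := exists_fld_ae_eq (isTest_smul_const hg hgc hgs ξ)
  have hpqv : inner ℝ (p - q) (fld v) = 0 := by
    rw [← toDual_apply, toDual_sub, hpq, sub_self, zero_apply]
  rw [inner_zero_left, real_inner_comm, ← integral_inner hint, ← hpqv, L2.inner_def]
  refine integral_congr_ae (hv.mono fun x hx => ?_)
  simp only [hx, real_inner_smul_right]
  rw [real_inner_comm]

end H0curl

/-! ### The data and the bilinear form -/

lemma IsC1.memLp {F : Type*} [NormedAddCommGroup F] [NormedSpace ℝ F] {B : Set E3} {u : E3 → F}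
    (hu : IsC1 B u) (hB : IsOpen B) (hB' : Bornology.IsBounded B) (p : ℝ≥0∞) :
    MemLp u p (volume.restrict B) := by
  have : IsFiniteMeasure (volume.restrict B) := isFiniteMeasure_restrict.2 hB'.measure_lt_top.ne
  obtain ⟨hcont, C, hC⟩ := hu
  exact .of_bound (hcont.continuousOn.aestronglyMeasurable hB.measurableSet) C
    ((ae_restrict_mem hB.measurableSet).mono fun x hx => (hC x hx).1)

/-- A uniformly elliptic tensor field on `Ω` with essentially bounded entries. -/
structure IsElliptic (Ω : Set E3) (M : E3 → Matrix (Fin 3) (Fin 3) ℝ) : Prop where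
  bounded : ∀ i j, MemLp (fun x => M x i j) ∞ (volume.restrict Ω)
  posDef : ∃ c : ℝ, 0 < c ∧ ∀ᵐ x ∂volume.restrict Ω, ∀ ξ : E3,
    c * ‖ξ‖ ^ 2 ≤ inner ℝ ξ (Matrix.toEuclideanLin (M x) ξ)

lemma memLp_linearMap_matrix {α m n F : Type*} [MeasurableSpace α] {μ : Measure α} [Finite m]
    [Finite n] [NormedAddCommGroup F] [NormedSpace ℝ F]
    {M : α → Matrix m n ℝ} {p : ℝ≥0∞} (hM : ∀ i j, MemLp (fun x => M x i j) p μ)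
    (Φ : Matrix m n ℝ →ₗ[ℝ] F) : MemLp (fun x => Φ (M x)) p μ := by
  classical
  cases nonempty_fintype m
  cases nonempty_fintype n
  have hsum : ∀ x, Φ (M x) = ∑ i, ∑ j, M x i j • Φ (Matrix.single i j 1) := fun x => by
    conv_lhs => rw [Matrix.matrix_eq_sum_single (M x)]
    simp only [map_sum, ← map_smul, Matrix.smul_single, smul_eq_mul, mul_one]
  simp only [hsum]
  exact memLp_finsetSum _ fun i _ => memLp_finsetSum _ fun j _ =>
    (ContinuousLinearMap.toSpanSingleton ℝ _).comp_memLp' (hM i j)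

namespace IsElliptic

variable {Ω : Set E3} {M : E3 → Matrix (Fin 3) (Fin 3) ℝ} (hM : IsElliptic Ω M)

/-- Multiplication by a tensor field in `L²(Ω; ℝ³)`. -/
def mul : L2 Ω →L[ℝ] L2 Ω :=
  mulOp (memLp_linearMap_matrix hM.bounded
    (LinearMap.toContinuousLinearMap.toLinearMap ∘ₗ Matrix.toEuclideanLin.toLinearMap))

lemma inner_mul (p q : L2 Ω) : inner ℝ (hM.mul p) q =
    ∫ x in Ω, inner ℝ (Matrix.toEuclideanLin (M x) (p x)) (q x) :=
  inner_mulOp _ p q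

lemma exists_coercive : ∃ c > 0, ∀ p : L2 Ω, c * ‖p‖ ^ 2 ≤ inner ℝ (hM.mul p) p := by
  obtain ⟨c, hc, hcM⟩ := hM.posDef
  exact ⟨c, hc, mul_norm_sq_le_inner_mulOp _ hcM⟩

end IsElliptic

/-- Admissible data in a weak sense: `Ω` is open, `B ⊆ Ω` is bounded and measurable, and all
coefficients and sources are Lebesgue functions. -/
structure Data.WeaklyAdmissible (D : Data) : Prop where
  isOpen : IsOpen D.Ω
  subset : D.B ⊆ D.Ω
  measurableSet : MeasurableSet D.B
  isBounded : Bornology.IsBounded D.B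
  target : MemLp D.Ed 2 (volume.restrict D.B)
  weight : MemLp D.κ ∞ (volume.restrict D.B)
  jc_nonneg : 0 ≤ D.jc
  permittivity : IsElliptic D.Ω D.ε
  reluctivity : IsElliptic D.Ω D.ν
  source : MemLp D.f 2 (volume.restrict D.Ω)

lemma Data.Admissible.weaklyAdmissible {D : Data} (hD : D.Admissible) : D.WeaklyAdmissible where
  isOpen := hD.domain.isOpen
  subset := hD.subset
  measurableSet := hD.lipB.isOpen.measurableSet
  isBounded := hD.lipB.isBounded
  target := hD.target.memLp hD.lipB.isOpen hD.lipB.isBounded 2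
  weight := hD.weight.memLp hD.lipB.isOpen hD.lipB.isBounded ∞
  jc_nonneg := hD.jc_pos.le
  permittivity := ⟨hD.permittivity.bounded, hD.permittivity.posDef⟩
  reluctivity := ⟨hD.reluctivity.bounded, hD.reluctivity.posDef⟩
  source := hD.source

namespace Data

variable {D : Data} {ω ω' : Set E3}

namespace WeaklyAdmissible

variable (hD : D.WeaklyAdmissible)

/-- The operator on `H₀(curl)` representing the form `a`, see `a_eq_inner_stateOp`. -/
def stateOp : H0curl D.Ω →L[ℝ] H0curl D.Ω :=
  (rotL D.Ω).adjoint ∘L hD.reluctivity.mul ∘L rotL D.Ω +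
    (fldL D.Ω).adjoint ∘L hD.permittivity.mul ∘L fldL D.Ω

lemma inner_stateOp (v w : H0curl D.Ω) : inner ℝ (hD.stateOp v) w =
    inner ℝ (hD.reluctivity.mul (rot v)) (rot w) +
      inner ℝ (hD.permittivity.mul (fld v)) (fld w) := by
  simp only [stateOp, add_apply, ContinuousLinearMap.comp_apply, inner_add_left,
    ContinuousLinearMap.adjoint_inner_left]
  rfl

lemma a_eq_inner_stateOp (v w : H0curl D.Ω) : D.a v w = inner ℝ (hD.stateOp v) w := by
  rw [inner_stateOp, IsElliptic.inner_mul, IsElliptic.inner_mul, a]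

lemma exists_coercive : ∃ c > 0, ∀ v, c * ‖v‖ ^ 2 ≤ inner ℝ (hD.stateOp v) v := by
  obtain ⟨c₁, hc₁, hν⟩ := hD.reluctivity.exists_coercive
  obtain ⟨c₂, hc₂, hε⟩ := hD.permittivity.exists_coercive
  refine ⟨min c₁ c₂, lt_min hc₁ hc₂, fun v => ?_⟩
  calc min c₁ c₂ * ‖v‖ ^ 2 = min c₁ c₂ * ‖rot v‖ ^ 2 + min c₁ c₂ * ‖fld v‖ ^ 2 := by
        rw [norm_sq_eq]
        ring
    _ ≤ c₁ * ‖rot v‖ ^ 2 + c₂ * ‖fld v‖ ^ 2 := by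
        gcongr
        exacts [min_le_left _ _, min_le_right _ _]
    _ ≤ inner ℝ (hD.stateOp v) v := by
        rw [inner_stateOp]
        exact add_le_add (hν _) (hε _)

lemma load_eq_toDual (v : H0curl D.Ω) : D.load v = toDual (hD.source.toLp D.f) v := by
  rw [toDual_apply, L2.inner_def]
  refine integral_congr_ae (hD.source.coeFn_toLp.mono fun x hx => ?_)
  simp only [hx]

include hD

lemma volume_ne_top (hωB : ω ⊆ D.B) : volume ω ≠ ∞ :=
  (hD.isBounded.subset hωB).measure_lt_top.ne

lemma restrict_ne_top (hωB : ω ⊆ D.B) : volume.restrict D.Ω ω ≠ ∞ :=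
  ne_top_of_le_ne_top (hD.volume_ne_top hωB) (Measure.restrict_apply_le _ _)

lemma restrict_restrict (hωB : ω ⊆ D.B) :
    (volume.restrict D.Ω).restrict ω = volume.restrict ω :=
  Measure.restrict_restrict_of_subset (hωB.trans hD.subset)

lemma phi_eq_norm (hω : MeasurableSet ω) (hωB : ω ⊆ D.B) (v : H0curl D.Ω) :
    D.phi ω v = D.jc * ‖indicatorMul 2 2 1 hω (hD.restrict_ne_top hωB) (fld v)‖ := by
  rw [norm_indicatorMul_one, hD.restrict_restrict hωB, phi]

lemma setIntegral_inner_eq_toDual (hω : MeasurableSet ω) (hωB : ω ⊆ D.B) {lam : L2 D.Ω}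
    (hlam : D.IsZeroExt ω lam) (v : H0curl D.Ω) :
    ∫ x in ω, inner ℝ (lam x) (fld v x) = toDual lam v := by
  rw [toDual_apply, L2.inner_def]
  refine (setIntegral_eq_of_subset_of_ae_sdiff_eq_zero hD.isOpen.measurableSet.nullMeasurableSet
    (hωB.trans hD.subset) ?_).symm
  filter_upwards [(ae_restrict_iff' (hD.isOpen.measurableSet.diff hω)).1 hlam] with x hx hxω
  rw [hx hxω, inner_zero_left]

end WeaklyAdmissible

end Data

/-! ### Approximate states and stability -/

lemma sq_mul_sq_le_of_mul_sq_le {c x s m : ℝ} (hc : 0 ≤ c) (h : c * x ^ 2 ≤ s + m * x) :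
    c ^ 2 * x ^ 2 ≤ 2 * c * s + m ^ 2 := by
  nlinarith [mul_le_mul_of_nonneg_left h hc, sq_nonneg (c * x - m)]

namespace Data

variable {D : Data} {ω ω' : Set E3} {E E' : H0curl D.Ω} {lam lam' : L2 D.Ω} {δ δ' γ : ℝ}

/-- `E` solves the variational inequality for the shape `ω` up to the error `δ`. The solutions of
the penalized problem are of this kind, with `δ → 0` as `γ → ∞`. -/
def IsApproxState (D : Data) (ω : Set E3) (δ : ℝ) (E : H0curl D.Ω) : Prop :=
  ∀ v : H0curl D.Ω, D.load (v - E) ≤ D.a E (v - E) + D.phi ω v - D.phi ω E + δ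

lemma isApproxState_zero : D.IsApproxState ω 0 E ↔ D.IsState ω E := by
  simp only [IsApproxState, IsState, add_zero]

namespace WeaklyAdmissible

variable (hD : D.WeaklyAdmissible)

lemma eqn_iff (hω : MeasurableSet ω) (hωB : ω ⊆ D.B) (hlam : D.IsZeroExt ω lam) :
    (∀ v, D.a E v + ∫ x in ω, inner ℝ (lam x) (fld v x) = D.load v) ↔
      hD.stateOp E + (fldL D.Ω).adjoint lam = (fldL D.Ω).adjoint (hD.source.toLp D.f) := by
  rw [ext_iff_inner_right ℝ]
  simp only [inner_add_left, ContinuousLinearMap.adjoint_inner_left,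
    fldL_apply, ← toDual_apply, ← hD.load_eq_toDual, ← hD.a_eq_inner_stateOp,
    hD.setIntegral_inner_eq_toDual hω hωB hlam]

include hD

lemma setIntegral_inner_le_phi (hωB : ω ⊆ D.B)
    (hlam : ∀ᵐ x ∂volume.restrict ω, ‖lam x‖ ≤ D.jc) (v : H0curl D.Ω) :
    ∫ x in ω, inner ℝ (lam x) (fld v x) ≤ D.phi ω v := by
  rw [phi, ← integral_const_mul, ← hD.restrict_restrict hωB]
  refine integral_mono_ae (L2.integrable_inner lam (fld v)).restrict
    ((integrableOn_norm (hD.restrict_ne_top hωB) (fld v)).const_mul _) ?_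
  rw [hD.restrict_restrict hωB]
  filter_upwards [hlam] with x hx
  exact (real_inner_le_norm _ _).trans (by gcongr)

lemma isApproxState_of_multiplier (hωB : ω ⊆ D.B)
    (heqn : ∀ v, D.a E v + ∫ x in ω, inner ℝ (lam x) (fld v x) = D.load v)
    (hbound : ∀ᵐ x ∂volume.restrict ω, ‖lam x‖ ≤ D.jc)
    (halign : D.phi ω E - δ ≤ ∫ x in ω, inner ℝ (lam x) (fld E x)) :
    D.IsApproxState ω δ E := by
  intro v
  have ha : D.a E (v - E) = D.a E v - D.a E E := by
    simp only [hD.a_eq_inner_stateOp, inner_sub_right]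
  have hload : D.load (v - E) = D.load v - D.load E := by
    simp only [hD.load_eq_toDual, map_sub]
  linarith [heqn v, heqn E, hD.setIntegral_inner_le_phi hωB hbound v]

lemma phi_sub_phi_le (hω : MeasurableSet ω) (hωB : ω ⊆ D.B) (hω' : MeasurableSet ω')
    (hωB' : ω' ⊆ D.B) (v w : H0curl D.Ω) :
    (D.phi ω w - D.phi ω v) - (D.phi ω' w - D.phi ω' v) ≤
      D.jc * √(volume.real (symmDiff ω ω')) * ‖v - w‖ := by
  have hωω' : MeasurableSet (symmDiff ω ω') := hω.symmDiff hω'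
  have hωωB : symmDiff ω ω' ⊆ D.B := Set.symmDiff_subset_union.trans (Set.union_subset hωB hωB')
  have hint : ∀ {S}, S ⊆ D.B → ∀ u : H0curl D.Ω, IntegrableOn (fun x => ‖fld u x‖) S := by
    intro S hS u
    rw [IntegrableOn, ← hD.restrict_restrict hS]
    exact integrableOn_norm (hD.restrict_ne_top hS) _
  have hdiff : ∫ x in symmDiff ω ω', |‖fld w x‖ - ‖fld v x‖| ≤
      √(volume.real (symmDiff ω ω')) * ‖v - w‖ := by
    calc ∫ x in symmDiff ω ω', |‖fld w x‖ - ‖fld v x‖|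
        ≤ ∫ x in symmDiff ω ω', ‖fld (w - v) x‖ := by
          refine integral_mono_ae ((hint hωωB w).sub (hint hωωB v)).abs (hint hωωB _) ?_
          have hsub : fld (w - v) =ᵐ[volume.restrict D.Ω] fld w - fld v :=
            Lp.coeFn_sub (fld w) (fld v)
          filter_upwards [ae_restrict_of_ae_restrict_of_subset (hωωB.trans hD.subset) hsub]
            with x hx
          rw [hx]
          exact abs_norm_sub_norm_le _ _
      _ ≤ √(volume.real (symmDiff ω ω')) * ‖fld (w - v)‖ := by
          have h := setIntegral_norm_le hωω' (hD.restrict_ne_top hωωB) (fld (w - v))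
          rwa [hD.restrict_restrict hωωB, measureReal_restrict_apply hωω',
            Set.inter_eq_left.2 (hωωB.trans hD.subset)] at h
      _ ≤ _ := by
          gcongr
          exact norm_sub_rev v w ▸ norm_fld_le _
  have hsymm := setIntegral_sub_setIntegral_le hω hω' ((hint hωB w).sub (hint hωB v))
    ((hint hωB' w).sub (hint hωB' v))
  simp only [Pi.sub_apply] at hsymm
  rw [integral_sub (hint hωB w) (hint hωB v), integral_sub (hint hωB' w) (hint hωB' v)] at hsymm
  simp only [phi, ← mul_sub, mul_assoc]
  exact mul_le_mul_of_nonneg_left (hsymm.trans hdiff) hD.jc_nonneg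

end WeaklyAdmissible

namespace IsApproxState

lemma mul_norm_sub_sq_le (hE : D.IsApproxState ω δ E) (hE' : D.IsApproxState ω' δ' E')
    (hD : D.WeaklyAdmissible) {c : ℝ} (hc : ∀ v, c * ‖v‖ ^ 2 ≤ inner ℝ (hD.stateOp v) v)
    (hω : MeasurableSet ω) (hωB : ω ⊆ D.B) (hω' : MeasurableSet ω') (hωB' : ω' ⊆ D.B) :
    c * ‖E - E'‖ ^ 2 ≤ (δ + δ') + D.jc * √(volume.real (symmDiff ω ω')) * ‖E - E'‖ := by
  have hload : D.load (E' - E) = - D.load (E - E') := by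
    rw [← neg_sub E E', hD.load_eq_toDual, hD.load_eq_toDual, map_neg]
  have ha : D.a E (E' - E) + D.a E' (E - E') = - inner ℝ (hD.stateOp (E - E')) (E - E') := by
    rw [← neg_sub E E', hD.a_eq_inner_stateOp, hD.a_eq_inner_stateOp, inner_neg_right, map_sub,
      inner_sub_left]
    ring
  linarith [hE E', hE' E, hc (E - E'), hD.phi_sub_phi_le hω hωB hω' hωB' E E']

theorem tendsto_norm_sub {ι : Type*} {l : Filter ι} {ω ω' : ι → Set E3} {δ δ' : ι → ℝ}
    {E E' : ι → H0curl D.Ω} (hE : ∀ i, D.IsApproxState (ω i) (δ i) (E i))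
    (hE' : ∀ i, D.IsApproxState (ω' i) (δ' i) (E' i)) (hD : D.WeaklyAdmissible)
    (hω : ∀ i, MeasurableSet (ω i)) (hωB : ∀ i, ω i ⊆ D.B) (hω' : ∀ i, MeasurableSet (ω' i))
    (hωB' : ∀ i, ω' i ⊆ D.B) (hδ : Tendsto δ l (𝓝 0)) (hδ' : Tendsto δ' l (𝓝 0))
    (hvol : Tendsto (fun i => volume (symmDiff (ω i) (ω' i))) l (𝓝 0)) :
    Tendsto (fun i => ‖E i - E' i‖) l (𝓝 0) := by
  obtain ⟨c, hc, hcoer⟩ := hD.exists_coercive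
  have hbound : ∀ i, c ^ 2 * ‖E i - E' i‖ ^ 2 ≤
      2 * c * (δ i + δ' i) + (D.jc * √(volume.real (symmDiff (ω i) (ω' i)))) ^ 2 := fun i =>
    sq_mul_sq_le_of_mul_sq_le hc.le
      ((hE i).mul_norm_sub_sq_le (hE' i) hD hcoer (hω i) (hωB i) (hω' i) (hωB' i))
  have hvol' : Tendsto (fun i => volume.real (symmDiff (ω i) (ω' i))) l (𝓝 0) :=
    (ENNReal.tendsto_toReal ENNReal.zero_ne_top).comp hvol
  have hlim : Tendsto (fun i => 2 * c * (δ i + δ' i) +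
      (D.jc * √(volume.real (symmDiff (ω i) (ω' i)))) ^ 2) l (𝓝 0) := by
    simpa using ((hδ.add hδ').const_mul (2 * c)).add ((hvol'.sqrt.const_mul D.jc).pow 2)
  have hsq := squeeze_zero (fun i => by positivity) hbound hlim
  have hmul : Tendsto (fun i => c * ‖E i - E' i‖) l (𝓝 0) := by
    have hsqrt := hsq.sqrt
    simp only [← mul_pow, Real.sqrt_zero] at hsqrt
    exact hsqrt.congr fun i => Real.sqrt_sq (by positivity)
  simpa [hc.ne'] using hmul.const_mul c⁻¹

end IsApproxState

end Data

/-! ### Penalized states -/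

namespace Data

variable {D : Data} {ω : Set E3} {E : H0curl D.Ω} {lam : L2 D.Ω} {γ : ℝ}

namespace WeaklyAdmissible

variable (hD : D.WeaklyAdmissible)

/-- The multiplier of the penalized problem as a function of the field: the penalized constitutive
law applied to `p` on `ω`, and zero elsewhere. -/
def penMult (hω : MeasurableSet ω) (hωB : ω ⊆ D.B) (hγ : 0 < γ) (p : L2 D.Ω) : L2 D.Ω :=
  indicatorMul ∞ 2 2 hω (hD.restrict_ne_top hωB)
    ((lipschitzWith_penLaw hD.jc_nonneg hγ).compLp (smul_zero _) p)

lemma coeFn_penMult (hω : MeasurableSet ω) (hωB : ω ⊆ D.B) (hγ : 0 < γ) (p : L2 D.Ω) :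
    hD.penMult hω hωB hγ p =ᵐ[volume.restrict D.Ω]
      ω.indicator fun x => penLaw D.jc γ (p x) := by
  filter_upwards [coeFn_indicatorMul (p := ∞) (s := 2) hω (hD.restrict_ne_top hωB)
      ((lipschitzWith_penLaw hD.jc_nonneg hγ).compLp (smul_zero _) p),
    LipschitzWith.coeFn_compLp (lipschitzWith_penLaw hD.jc_nonneg hγ) (smul_zero _) p]
    with x hx hpx
  rw [penMult, hx]
  exact Set.indicator_eq_indicator .rfl hpx

lemma exists_lipschitzWith_penMult (hω : MeasurableSet ω) (hωB : ω ⊆ D.B) (hγ : 0 < γ) :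
    ∃ K, LipschitzWith K (hD.penMult hω hωB hγ) :=
  ⟨_, (ContinuousLinearMap.lipschitz _).comp (LipschitzWith.lipschitzWith_compLp _ _)⟩

lemma inner_penMult_sub_nonneg (hω : MeasurableSet ω) (hωB : ω ⊆ D.B) (hγ : 0 < γ)
    (p q : L2 D.Ω) :
    0 ≤ inner ℝ (hD.penMult hω hωB hγ p - hD.penMult hω hωB hγ q) (p - q) := by
  rw [L2.inner_def]
  refine integral_nonneg_of_ae ?_
  filter_upwards [Lp.coeFn_sub (hD.penMult hω hωB hγ p) (hD.penMult hω hωB hγ q),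
    Lp.coeFn_sub p q, hD.coeFn_penMult hω hωB hγ p, hD.coeFn_penMult hω hωB hγ q]
    with x h₁ h₂ hp hq
  rw [h₁, h₂, Pi.sub_apply, Pi.sub_apply, hp, hq]
  by_cases hx : x ∈ ω
  · simp only [Set.indicator_of_mem hx]
    exact inner_penLaw_sub_nonneg hD.jc_nonneg hγ (p x) (q x)
  · simp only [Set.indicator_of_notMem hx, sub_zero, inner_zero_left, Pi.zero_apply, le_refl]

include hD in
theorem exists_isPenSol (hω : MeasurableSet ω) (hωB : ω ⊆ D.B) (hγ : 0 < γ) :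
    ∃ E lam, D.IsPenSol γ ω E lam := by
  obtain ⟨c, hc, hcoer⟩ := hD.exists_coercive
  obtain ⟨K, hK⟩ := hD.exists_lipschitzWith_penMult hω hωB hγ
  let T : H0curl D.Ω → H0curl D.Ω := fun v =>
    hD.stateOp v + (fldL D.Ω).adjoint (hD.penMult hω hωB hγ (fldL D.Ω v))
  have hlip := hD.stateOp.lipschitz.add
    ((fldL D.Ω).adjoint.lipschitz.comp (hK.comp (fldL D.Ω).lipschitz))
  have hmono : ∀ v w, c * ‖v - w‖ ^ 2 ≤ inner ℝ (T v - T w) (v - w) := fun v w => by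
    rw [add_sub_add_comm, ← map_sub, ← map_sub, inner_add_left,
      ContinuousLinearMap.adjoint_inner_left, map_sub (fldL D.Ω)]
    exact (hcoer _).trans (le_add_of_nonneg_right (hD.inner_penMult_sub_nonneg hω hωB hγ _ _))
  obtain ⟨E, hE⟩ := surjective_of_stronglyMonotone (T := T) hlip hc hmono
    ((fldL D.Ω).adjoint (hD.source.toLp D.f))
  have hpen := hD.coeFn_penMult hω hωB hγ (fld E)
  have hzero : D.IsZeroExt ω (hD.penMult hω hωB hγ (fld E)) := by
    filter_upwards [ae_restrict_of_ae_restrict_of_subset Set.sdiff_subset hpen,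
      ae_restrict_mem (hD.isOpen.measurableSet.diff hω)] with x hx hxω
    rw [hx, Set.indicator_of_notMem hxω.2]
  refine ⟨E, hD.penMult hω hωB hγ (fld E), hzero, (hD.eqn_iff hω hωB hzero).2 hE, ?_⟩
  filter_upwards [ae_restrict_of_ae_restrict_of_subset (hωB.trans hD.subset) hpen,
    ae_restrict_mem hω] with x hx hxω
  rw [hx, Set.indicator_of_mem hxω, penLaw]

end WeaklyAdmissible

/-- The error with which penalized states solve the variational inequality. -/
def penError (D : Data) (γ : ℝ) : ℝ := D.jc / γ * (1 + 1 / (2 * γ)) * volume.real D.B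

lemma tendsto_penError {ι : Type*} {l : Filter ι} {γ : ι → ℝ} (hγ : Tendsto γ l atTop) :
    Tendsto (fun i => D.penError (γ i)) l (𝓝 0) := by
  have hγ' : Tendsto (fun i => 1 / (2 * γ i)) l (𝓝 0) :=
    (hγ.const_mul_atTop two_pos).const_div_atTop 1
  simpa only [penError, zero_mul] using
    ((hγ.const_div_atTop D.jc).mul (hγ'.const_add 1)).mul_const (volume.real D.B)

lemma IsPenSol.isApproxState (hE : D.IsPenSol γ ω E lam) (hD : D.WeaklyAdmissible)
    (hωB : ω ⊆ D.B) (hγ : 0 < γ) : D.IsApproxState ω (D.penError γ) E := by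
  have hlaw : ∀ᵐ x ∂volume.restrict ω, lam x = penLaw D.jc γ (fld E x) := hE.law
  refine hD.isApproxState_of_multiplier hωB hE.eqn
    (hlaw.mono fun x hx => hx ▸ norm_penLaw_le hD.jc_nonneg hγ _) ?_
  have hvol : volume.real ω ≤ volume.real D.B :=
    measureReal_mono hωB (hD.volume_ne_top subset_rfl)
  have hjc := hD.jc_nonneg
  have hnorm : IntegrableOn (fun x => D.jc * ‖fld E x‖) ω := by
    rw [IntegrableOn, ← hD.restrict_restrict hωB]
    exact (integrableOn_norm (hD.restrict_ne_top hωB) _).const_mul _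
  have hconst : IntegrableOn (fun _ : E3 => D.jc / γ * (1 + 1 / (2 * γ))) ω :=
    integrableOn_const (hD.volume_ne_top hωB)
  calc D.phi ω E - D.penError γ
      ≤ D.jc * (∫ x in ω, ‖fld E x‖) - volume.real ω * (D.jc / γ * (1 + 1 / (2 * γ))) := by
        rw [phi, penError, mul_comm (volume.real ω)]
        gcongr
    _ = ∫ x in ω, (D.jc * ‖fld E x‖ - D.jc / γ * (1 + 1 / (2 * γ))) := by
        rw [integral_sub hnorm hconst, integral_const_mul, setIntegral_const, smul_eq_mul]
    _ ≤ ∫ x in ω, inner ℝ (lam x) (fld E x) := by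
        refine integral_mono_ae (hnorm.sub hconst) ?_ (hlaw.mono fun x hx => ?_)
        · rw [← hD.restrict_restrict hωB]
          exact (L2.integrable_inner lam (fld E)).restrict
        · simp only [hx]
          exact le_inner_penLaw hjc hγ _

/-! ### Existence and uniqueness of the state -/

lemma IsState.eq {E' : H0curl D.Ω} (hE : D.IsState ω E) (hE' : D.IsState ω E')
    (hD : D.WeaklyAdmissible) (hω : MeasurableSet ω) (hωB : ω ⊆ D.B) : E = E' := by
  have hlim := IsApproxState.tendsto_norm_sub (l := atTop) (ι := ℕ)
    (fun _ => isApproxState_zero.2 hE) (fun _ => isApproxState_zero.2 hE') hD (fun _ => hω)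
    (fun _ => hωB) (fun _ => hω) (fun _ => hωB) tendsto_const_nhds tendsto_const_nhds
    (by simp only [symmDiff_self, Set.bot_eq_empty, measure_empty, tendsto_const_nhds])
  exact sub_eq_zero.1 (norm_eq_zero.1 (tendsto_nhds_unique tendsto_const_nhds hlim))

lemma WeaklyAdmissible.continuous_phi (hD : D.WeaklyAdmissible) (hω : MeasurableSet ω)
    (hωB : ω ⊆ D.B) : Continuous (D.phi ω) := by
  simp only [funext (hD.phi_eq_norm hω hωB)]
  exact ((ContinuousLinearMap.continuous _).comp (fldL D.Ω).continuous).norm.const_mul _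

lemma WeaklyAdmissible.isState_of_tendsto (hD : D.WeaklyAdmissible) (hω : MeasurableSet ω)
    (hωB : ω ⊆ D.B) {E : ℕ → H0curl D.Ω} {E' : H0curl D.Ω} {δ : ℕ → ℝ}
    (hE : ∀ n, D.IsApproxState ω (δ n) (E n)) (hδ : Tendsto δ atTop (𝓝 0))
    (hlim : Tendsto E atTop (𝓝 E')) : D.IsState ω E' := by
  intro v
  have hload : Continuous D.load := by
    simp only [funext hD.load_eq_toDual]
    exact (toDual _).continuous
  have ha : Continuous fun w => D.a w (v - w) := by
    simp only [hD.a_eq_inner_stateOp]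
    fun_prop
  have hphi := hD.continuous_phi hω hωB
  have hleft : Continuous fun w => D.load (v - w) := by fun_prop
  have hright : Continuous fun w => D.a w (v - w) + D.phi ω v - D.phi ω w := by fun_prop
  refine le_of_tendsto_of_tendsto' ((hleft.tendsto E').comp hlim) ?_ fun n => hE n v
  simpa only [add_zero, Function.comp_apply] using ((hright.tendsto E').comp hlim).add hδ

theorem WeaklyAdmissible.exists_isState (hD : D.WeaklyAdmissible) (hω : MeasurableSet ω)
    (hωB : ω ⊆ D.B) : ∃ E, D.IsState ω E := by
  have hpos : ∀ n : ℕ, (0 : ℝ) < n + 1 := fun n => n.cast_add_one_pos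
  choose E lam hE using fun n : ℕ => hD.exists_isPenSol hω hωB (hpos n)
  have happrox := fun n => (hE n).isApproxState hD hωB (hpos n)
  have herr : Tendsto (fun n : ℕ => D.penError (n + 1)) atTop (𝓝 0) :=
    tendsto_penError (tendsto_atTop_add_const_right _ _ tendsto_natCast_atTop_atTop)
  have hcauchy : CauchySeq E := by
    simp only [cauchySeq_iff_tendsto_dist_atTop_0, dist_eq_norm, ← prod_atTop_atTop_eq]
    exact IsApproxState.tendsto_norm_sub (fun i => happrox i.1) (fun i => happrox i.2) hD
      (fun _ => hω) (fun _ => hωB) (fun _ => hω) (fun _ => hωB) (herr.comp tendsto_fst)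
      (herr.comp tendsto_snd)
      (by simp only [symmDiff_self, Set.bot_eq_empty, measure_empty, tendsto_const_nhds])
  obtain ⟨E', hE'⟩ := cauchySeq_tendsto_of_complete hcauchy
  exact ⟨E', hD.isState_of_tendsto hω hωB happrox herr hE'⟩

end Data

/-! ### Multipliers -/

theorem exists_extension_comp {V X : Type*} [AddCommGroup V] [Module ℝ V] [NormedAddCommGroup X]
    [NormedSpace ℝ X] (T : V →ₗ[ℝ] X) (G : V →ₗ[ℝ] ℝ) {C : ℝ} (hC : 0 ≤ C)
    (hG : ∀ v, G v ≤ C * ‖T v‖) :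
    ∃ g : X →L[ℝ] ℝ, (∀ v, g (T v) = G v) ∧ ∀ x, g x ≤ C * ‖x‖ := by
  have hG' : ∀ v, ‖G v‖ ≤ C * ‖T v‖ := fun v =>
    abs_le'.2 ⟨hG v, by simpa only [map_neg, norm_neg] using hG (-v)⟩
  obtain ⟨g₀, hg₀⟩ : G ∈ LinearMap.range T.dualMap := by
    rw [LinearMap.range_dualMap_eq_dualAnnihilator_ker, Submodule.mem_dualAnnihilator]
    intro v hv
    simpa only [LinearMap.mem_ker.1 hv, norm_zero, mul_zero, norm_le_zero_iff] using hG' v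
  have hg₀T : ∀ v, g₀ (T v) = G v := fun v => LinearMap.congr_fun hg₀ v
  have hbound : ∀ y : LinearMap.range T, ‖g₀.domRestrict _ y‖ ≤ C * ‖y‖ := by
    rintro ⟨_, v, rfl⟩
    simpa only [LinearMap.domRestrict_apply, hg₀T, Submodule.coe_norm] using hG' v
  obtain ⟨g, hg, hnorm⟩ := exists_extension_norm_eq _
    ((g₀.domRestrict (LinearMap.range T)).mkContinuous C hbound)
  refine ⟨g, fun v => (hg ⟨T v, v, rfl⟩).trans (hg₀T v), fun x => ?_⟩
  calc g x ≤ ‖g‖ * ‖x‖ := (le_abs_self _).trans (g.le_opNorm x)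
    _ ≤ C * ‖x‖ := by
        gcongr
        exact hnorm.trans_le (LinearMap.mkContinuous_norm_le _ hC _)

namespace Data

variable {D : Data} {ω : Set E3} {E E' : H0curl D.Ω} {lam lam' : L2 D.Ω}

lemma IsState.load_sub_a_le_phi (hE : D.IsState ω E) (hD : D.WeaklyAdmissible)
    (hω : MeasurableSet ω) (hωB : ω ⊆ D.B) (v : H0curl D.Ω) :
    D.load v - D.a E v ≤ D.phi ω v := by
  have htri : D.phi ω (E + v) ≤ D.phi ω E + D.phi ω v := by
    simp only [hD.phi_eq_norm hω hωB, ← mul_add]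
    refine mul_le_mul_of_nonneg_left ?_ hD.jc_nonneg
    exact (congrArg norm (map_add _ (fld E) (fld v))).trans_le (norm_add_le _ _)
  have h := hE (E + v)
  rw [add_sub_cancel_left] at h
  linarith

lemma IsState.phi_le_load_sub_a (hE : D.IsState ω E) (hD : D.WeaklyAdmissible)
    (hω : MeasurableSet ω) (hωB : ω ⊆ D.B) : D.phi ω E ≤ D.load E - D.a E E := by
  have h := hE 0
  have hphi : D.phi ω 0 = 0 := by
    rw [hD.phi_eq_norm hω hωB, ← fldL_apply, map_zero, map_zero, norm_zero, mul_zero]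
  rw [zero_sub, hphi, hD.load_eq_toDual, hD.a_eq_inner_stateOp, map_neg, inner_neg_right,
    ← hD.load_eq_toDual, ← hD.a_eq_inner_stateOp] at h
  linarith

lemma IsState.exists_multiplier (hE : D.IsState ω E) (hD : D.WeaklyAdmissible)
    (hω : MeasurableSet ω) (hωB : ω ⊆ D.B) :
    ∃ lam : L2 D.Ω, (∀ v, D.a E v + toDual lam v = D.load v) ∧
      ∀ᵐ x ∂volume.restrict D.Ω, ‖lam x‖ ≤ ω.indicator (fun _ => D.jc) x := by
  let restr : L2 D.Ω →L[ℝ] Lp E3 1 (volume.restrict D.Ω) :=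
    indicatorMul 2 2 1 hω (hD.restrict_ne_top hωB)
  obtain ⟨g, hg, hgle⟩ := exists_extension_comp (restr ∘L fldL D.Ω).toLinearMap
    (toDual (hD.source.toLp D.f) - innerSL ℝ (hD.stateOp E)).toLinearMap hD.jc_nonneg fun v => by
      have h := hE.load_sub_a_le_phi hD hω hωB v
      rwa [hD.phi_eq_norm hω hωB, hD.load_eq_toDual, hD.a_eq_inner_stateOp] at h
  let lam : L2 D.Ω := (InnerProductSpace.toDual ℝ _).symm (g ∘L restr)
  have hlam : ∀ p, inner ℝ lam p = g (restr p) := fun p =>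
    InnerProductSpace.toDual_symm_apply
  refine ⟨lam, fun v => ?_, ?_⟩
  · rw [toDual_apply, hlam, hD.load_eq_toDual, hD.a_eq_inner_stateOp]
    exact add_eq_of_eq_sub' (hg v)
  · refine ae_norm_le_of_inner_le (measurable_const.indicator hω)
      (Set.indicator_nonneg fun _ _ => hD.jc_nonneg) fun p => ?_
    calc inner ℝ lam p ≤ D.jc * ‖restr p‖ := (hlam p).trans_le (hgle _)
      _ = ∫ x in D.Ω, ω.indicator (fun _ => D.jc) x * ‖p x‖ := by
        rw [norm_indicatorMul_one, ← integral_const_mul, ← integral_indicator hω]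
        simp only [Set.indicator_mul_left]

theorem IsState.exists_isDualSol (hE : D.IsState ω E) (hD : D.WeaklyAdmissible)
    (hω : MeasurableSet ω) (hωB : ω ⊆ D.B) : ∃ lam, D.IsDualSol ω E lam := by
  obtain ⟨lam, heqn, hle⟩ := hE.exists_multiplier hD hω hωB
  have hzero : D.IsZeroExt ω lam := by
    filter_upwards [ae_restrict_of_ae_restrict_of_subset Set.sdiff_subset hle,
      ae_restrict_mem (hD.isOpen.measurableSet.diff hω)] with x hx hxω
    rwa [Set.indicator_of_notMem hxω.2, norm_le_zero_iff] at hx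
  have hbound : ∀ᵐ x ∂volume.restrict ω, ‖lam x‖ ≤ D.jc := by
    filter_upwards [ae_restrict_of_ae_restrict_of_subset (hωB.trans hD.subset) hle,
      ae_restrict_mem hω] with x hx hxω
    rwa [Set.indicator_of_mem hxω] at hx
  have heqn' : ∀ v, D.a E v + ∫ x in ω, inner ℝ (lam x) (fld v x) = D.load v := fun v => by
    rw [hD.setIntegral_inner_eq_toDual hω hωB hzero, heqn]
  refine ⟨lam, hzero, heqn', hbound, ?_⟩
  have hinner : IntegrableOn (fun x => inner ℝ (lam x) (fld E x)) ω := by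
    rw [IntegrableOn, ← hD.restrict_restrict hωB]
    exact (L2.integrable_inner lam (fld E)).restrict
  have hnorm : IntegrableOn (fun x => D.jc * ‖fld E x‖) ω := by
    rw [IntegrableOn, ← hD.restrict_restrict hωB]
    exact (integrableOn_norm (hD.restrict_ne_top hωB) _).const_mul _
  have hinner_le : (fun x => inner ℝ (lam x) (fld E x)) ≤ᵐ[volume.restrict ω]
      fun x => D.jc * ‖fld E x‖ :=
    hbound.mono fun x hx =>
      (real_inner_le_norm _ _).trans (mul_le_mul_of_nonneg_right hx (norm_nonneg _))
  refine (integral_eq_iff_of_ae_le hinner hnorm hinner_le).1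
    ((integral_mono_ae hinner hnorm hinner_le).antisymm ?_)
  have hphi := hE.phi_le_load_sub_a hD hω hωB
  rw [phi, ← integral_const_mul] at hphi
  linarith [heqn' E]

lemma IsDualSol.isState (hE : D.IsDualSol ω E lam) (hD : D.WeaklyAdmissible) (hωB : ω ⊆ D.B) :
    D.IsState ω E :=
  isApproxState_zero.1 <| hD.isApproxState_of_multiplier hωB hE.eqn hE.bound <| by
    rw [integral_congr_ae hE.align, integral_const_mul, phi, sub_zero]

lemma WeaklyAdmissible.norm_toDual_sub_le (hD : D.WeaklyAdmissible) {ω' : Set E3}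
    (hω : MeasurableSet ω) (hωB : ω ⊆ D.B) (hω' : MeasurableSet ω') (hωB' : ω' ⊆ D.B)
    (hlam : D.IsZeroExt ω lam) (hlam' : D.IsZeroExt ω' lam')
    (heqn : ∀ v, D.a E v + ∫ x in ω, inner ℝ (lam x) (fld v x) = D.load v)
    (heqn' : ∀ v, D.a E' v + ∫ x in ω', inner ℝ (lam' x) (fld v x) = D.load v) :
    ‖toDual lam - toDual lam'‖ ≤ ‖hD.stateOp‖ * ‖E - E'‖ := by
  have hadj := ((hD.eqn_iff hω hωB hlam).1 heqn).trans ((hD.eqn_iff hω' hωB' hlam').1 heqn').symm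
  have hsub : (fldL D.Ω).adjoint (lam - lam') = hD.stateOp (E' - E) := by
    rw [map_sub, map_sub, sub_eq_sub_iff_add_eq_add, add_comm, hadj, add_comm]
  rw [← toDual_sub, norm_toDual, hsub, norm_sub_rev E]
  exact hD.stateOp.le_opNorm _

theorem IsDualSol.eq (hE : D.IsDualSol ω E lam) (hE' : D.IsDualSol ω E' lam')
    (hD : D.WeaklyAdmissible) (hω : MeasurableSet ω) (hωB : ω ⊆ D.B) : E = E' ∧ lam = lam' := by
  obtain rfl := (hE.isState hD hωB).eq (hE'.isState hD hωB) hD hω hωB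
  refine ⟨rfl, toDual_injective hD.isOpen (sub_eq_zero.1 (norm_le_zero_iff.1 ?_))⟩
  simpa only [sub_self, norm_zero, mul_zero] using
    hD.norm_toDual_sub_le hω hωB hω hωB hE.zeroExt hE'.zeroExt hE.eqn hE'.eqn

end Data

/-! ### Convergence of penalized states, costs and minimizers -/

namespace Data

variable {D : Data} {O : Set (Set E3)} {ω : ℕ → Set E3} {ω' : Set E3} {E : ℕ → H0curl D.Ω}
  {lam : ℕ → L2 D.Ω} {E' : H0curl D.Ω} {γ : ℕ → ℝ}

theorem IsState.tendsto_of_isPenSol (hE' : D.IsState ω' E')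
    (hE : ∀ n, D.IsPenSol (γ n) (ω n) (E n) (lam n)) (hD : D.WeaklyAdmissible)
    (hω : ∀ n, MeasurableSet (ω n)) (hωB : ∀ n, ω n ⊆ D.B) (hω' : MeasurableSet ω')
    (hωB' : ω' ⊆ D.B) (hγ : ∀ n, 0 < γ n) (hγ_lim : Tendsto γ atTop atTop)
    (hvol : Tendsto (fun n => volume (symmDiff (ω n) ω')) atTop (𝓝 0)) :
    Tendsto (fun n => ‖E n - E'‖) atTop (𝓝 0) :=
  IsApproxState.tendsto_norm_sub (fun n => (hE n).isApproxState hD (hωB n) (hγ n))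
    (fun _ => isApproxState_zero.2 hE') hD hω hωB (fun _ => hω') (fun _ => hωB')
    (tendsto_penError hγ_lim) tendsto_const_nhds hvol

namespace WeaklyAdmissible

variable (hD : D.WeaklyAdmissible)

include hD

lemma continuous_tracking :
    Continuous fun E : H0curl D.Ω => ∫ x in D.B, D.κ x * ‖fld E x - D.Ed x‖ ^ 2 := by
  have hB := hD.restrict_restrict subset_rfl
  let R : L2 D.Ω →L[ℝ] Lp E3 2 ((volume.restrict D.Ω).restrict D.B) :=
    LpToLpRestrictCLM E3 E3 ℝ (volume.restrict D.Ω) 2 D.B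
  have hEd : MemLp D.Ed 2 ((volume.restrict D.Ω).restrict D.B) := hB ▸ hD.target
  have hκ : MemLp (fun x => D.κ x • ContinuousLinearMap.id ℝ E3) ∞
      ((volume.restrict D.Ω).restrict D.B) :=
    (ContinuousLinearMap.toSpanSingleton ℝ _).comp_memLp' (hB ▸ hD.weight)
  have hinner : ∀ E : H0curl D.Ω, ∫ x in D.B, D.κ x * ‖fld E x - D.Ed x‖ ^ 2 =
      inner ℝ (mulOp hκ (R (fldL D.Ω E) - hEd.toLp)) (R (fldL D.Ω E) - hEd.toLp) := fun E => by
    rw [inner_mulOp]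
    conv_lhs => rw [← hB]
    refine integral_congr_ae ?_
    filter_upwards [Lp.coeFn_sub (R (fldL D.Ω E)) hEd.toLp, hEd.coeFn_toLp,
      LpToLpRestrictCLM_coeFn ℝ D.B (fldL D.Ω E)] with x hsub hx hRx
    rw [hsub, Pi.sub_apply, hx, hRx, smul_apply, ContinuousLinearMap.id_apply,
      real_inner_smul_left, real_inner_self_eq_norm_sq, fldL_apply]
  simp only [hinner]
  fun_prop

lemma tendsto_cost (hω : ∀ n, MeasurableSet (ω n)) (hωB : ∀ n, ω n ⊆ D.B)
    (hω' : MeasurableSet ω') (hωB' : ω' ⊆ D.B) (hE : Tendsto (fun n => ‖E n - E'‖) atTop (𝓝 0))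
    (hvol : Tendsto (fun n => volume (symmDiff (ω n) ω')) atTop (𝓝 0)) :
    Tendsto (fun n => D.cost (ω n) (E n)) atTop (𝓝 (D.cost ω' E')) := by
  have hvol' : Tendsto (fun n => volume.real (ω n)) atTop (𝓝 (volume.real ω')) := by
    refine tendsto_iff_dist_tendsto_zero.2 (squeeze_zero (fun _ => dist_nonneg) (fun n => ?_)
      ((ENNReal.tendsto_toReal ENNReal.zero_ne_top).comp hvol))
    exact abs_measureReal_sub_le_measureReal_symmDiff' (hω n).nullMeasurableSet
      hω'.nullMeasurableSet (hD.volume_ne_top (hωB n)) (hD.volume_ne_top hωB')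
  simp only [cost, setIntegral_const, smul_eq_mul, mul_one]
  exact (((hD.continuous_tracking.tendsto E').comp
    (tendsto_iff_norm_sub_tendsto_zero.2 hE)).const_mul _).add hvol'

theorem isOptimal_of_isPenOptimal (hO : ∀ ω ∈ O, MeasurableSet ω ∧ ω ⊆ D.B)
    (hγ : ∀ n, 0 < γ n) (hγ_lim : Tendsto γ atTop atTop)
    (hω : ∀ n, D.IsPenOptimal (γ n) O (ω n)) (hω' : ω' ∈ O)
    (hvol : Tendsto (fun n => volume (symmDiff (ω n) ω')) atTop (𝓝 0)) : D.IsOptimal O ω' := by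
  choose hωO E lam hE hmin using hω
  have hmeas := fun n => (hO _ (hωO n)).1
  have hsub := fun n => (hO _ (hωO n)).2
  obtain ⟨hmeas', hsub'⟩ := hO _ hω'
  obtain ⟨E', hE'⟩ := hD.exists_isState hmeas' hsub'
  refine ⟨hω', E', hE', fun ω₀ hω₀ E₀ hE₀ => ?_⟩
  obtain ⟨hmeas₀, hsub₀⟩ := hO _ hω₀
  choose F mu hF using fun n => hD.exists_isPenSol hmeas₀ hsub₀ (hγ n)
  have hvol₀ : Tendsto (fun _ : ℕ => volume (symmDiff ω₀ ω₀)) atTop (𝓝 0) := by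
    simp only [symmDiff_self, Set.bot_eq_empty, measure_empty, tendsto_const_nhds]
  have hEE' := hE'.tendsto_of_isPenSol hE hD hmeas hsub hmeas' hsub' hγ hγ_lim hvol
  have hFE₀ := hE₀.tendsto_of_isPenSol hF hD (fun _ => hmeas₀) (fun _ => hsub₀) hmeas₀ hsub₀ hγ
    hγ_lim hvol₀
  exact le_of_tendsto_of_tendsto' (hD.tendsto_cost hmeas hsub hmeas' hsub' hEE' hvol)
    (hD.tendsto_cost (fun _ => hmeas₀) (fun _ => hsub₀) hmeas₀ hsub₀ hFE₀ hvol₀)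
    fun n => hmin n ω₀ hω₀ (F n) (mu n) (hF n)

end WeaklyAdmissible

theorem IsDualSol.tendsto_of_isPenSol {lam' : L2 D.Ω} (hE' : D.IsDualSol ω' E' lam')
    (hE : ∀ n, D.IsPenSol (γ n) (ω n) (E n) (lam n)) (hD : D.WeaklyAdmissible)
    (hω : ∀ n, MeasurableSet (ω n)) (hωB : ∀ n, ω n ⊆ D.B) (hω' : MeasurableSet ω')
    (hωB' : ω' ⊆ D.B) (hlim : Tendsto (fun n => ‖E n - E'‖) atTop (𝓝 0)) :
    Tendsto (fun n => ‖toDual (lam n) - toDual lam'‖) atTop (𝓝 0) := by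
  refine squeeze_zero (fun _ => by positivity) (fun n => hD.norm_toDual_sub_le (hω n) (hωB n)
    hω' hωB' (hE n).zeroExt hE'.zeroExt (hE n).eqn hE'.eqn) ?_
  simpa only [mul_zero] using hlim.const_mul ‖hD.stateOp‖

end Data

end HTS

end

theorem theorem5p3_general (D : HTS.Data) (hD : D.WeaklyAdmissible)
    (L : ℝ≥0) (r h : ℝ) (hr : 0 < r) (hh : 0 < h)
    (γ : ℕ → ℝ) (hγ : ∀ n, 0 < γ n) (hγ_lim : Tendsto γ atTop atTop)
    (ω : ℕ → Set HTS.E3)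
    (hω : ∀ n, D.IsPenOptimal (γ n) (HTS.Shapes D.B L r h) (ω n))
    (E : ℕ → HTS.H0curl D.Ω) (lam : ℕ → HTS.L2 D.Ω)
    (hE : ∀ n, D.IsPenSol (γ n) (ω n) (E n) (lam n)) :
    ∃ s : ℕ → ℕ, StrictMono s ∧ ∃ ωs : Set HTS.E3,
      D.IsOptimal (HTS.Shapes D.B L r h) ωs ∧
      HTS.HausdorffConv (fun k => ω (s k)) ωs ∧
      HTS.CharConv (fun k => ω (s k)) ωs ∧
      ∃ (Es : HTS.H0curl D.Ω) (lams : HTS.L2 D.Ω),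
        D.IsState ωs Es ∧ D.IsDualSol ωs Es lams ∧
        (∀ E' lam', D.IsDualSol ωs E' lam' → E' = Es ∧ lam' = lams) ∧
        Tendsto (fun k => ‖E (s k) - Es‖) atTop (𝓝 0) ∧
        Tendsto (fun k => ‖HTS.toDual (lam (s k)) - HTS.toDual lams‖) atTop (𝓝 0) := by
  have hO : ∀ ω ∈ HTS.Shapes D.B L r h, MeasurableSet ω ∧ ω ⊆ D.B :=
    fun ω hω => ⟨hω.2.1.measurableSet, hω.1⟩
  obtain ⟨s, hs, ωs, hωs, hconv⟩ := HTS.exists_subseq_hausdorffConv hD.isBounded fun n => (hω n).1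
  replace hω := fun k => hω (s k)
  replace hE := fun k => hE (s k)
  replace hγ := fun k => hγ (s k)
  replace hγ_lim := hγ_lim.comp hs.tendsto_atTop
  have hmeas := fun k => (hO _ (hω k).1).1
  have hsub := fun k => (hO _ (hω k).1).2
  obtain ⟨hmeas', hsub'⟩ := hO ωs hωs
  have hvol := hconv.tendsto_volume_symmDiff hr hh hD.isBounded (fun k => (hω k).1) hωs
  obtain ⟨Es, hEs⟩ := hD.exists_isState hmeas' hsub'
  obtain ⟨lams, hlams⟩ := hEs.exists_isDualSol hD hmeas' hsub'
  have hlim := hEs.tendsto_of_isPenSol hE hD hmeas hsub hmeas' hsub' hγ hγ_lim hvol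
  exact ⟨s, hs, ωs, hD.isOptimal_of_isPenOptimal hO hγ hγ_lim hω hωs hvol, hconv,
    HTS.charConv_of_tendsto_volume_symmDiff hmeas hmeas' hvol, Es, lams, hEs, hlams,
    fun _ _ h' => h'.eq hlams hD hmeas' hsub', hlim,
    hlams.tendsto_of_isPenSol hE hD hmeas hsub hmeas' hsub' hlim⟩

theorem theorem5p3 (D : HTS.Data) (hD : D.Admissible)
    (L : ℝ≥0) (r h : ℝ) (hr : 0 < r) (hh : 0 < h)
    (γ : ℕ → ℝ) (hγ : ∀ n, 0 < γ n) (hγ_lim : Tendsto γ atTop atTop)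
    (ω : ℕ → Set HTS.E3)
    (hω : ∀ n, D.IsPenOptimal (γ n) (HTS.Shapes D.B L r h) (ω n))
    (E : ℕ → HTS.H0curl D.Ω) (lam : ℕ → HTS.L2 D.Ω)
    (hE : ∀ n, D.IsPenSol (γ n) (ω n) (E n) (lam n)) :
    ∃ s : ℕ → ℕ, StrictMono s ∧ ∃ ωs : Set HTS.E3,
      D.IsOptimal (HTS.Shapes D.B L r h) ωs ∧
      HTS.HausdorffConv (fun k => ω (s k)) ωs ∧
      HTS.CharConv (fun k => ω (s k)) ωs ∧
      ∃ (Es : HTS.H0curl D.Ω) (lams : HTS.L2 D.Ω),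
        D.IsState ωs Es ∧ D.IsDualSol ωs Es lams ∧
        (∀ E' lam', D.IsDualSol ωs E' lam' → E' = Es ∧ lam' = lams) ∧
        Tendsto (fun k => ‖E (s k) - Es‖) atTop (𝓝 0) ∧
        Tendsto (fun k => ‖HTS.toDual (lam (s k)) - HTS.toDual lams‖) atTop (𝓝 0) :=
  theorem5p3_general D hD.weaklyAdmissible L r h hr hh γ hγ hγ_lim ω hω E lam hE
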